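/- Let $R$ be an associative ring with identity. A ring homomorphism $f\colon R\to S$ makes $S$ a *perfect symmetric ring of quotients* of $R$ if $f$ is an epimorphism of rings and $S$ is flat both as a left and as a right $R$-module via $f$. A left ideal $I$ of $R$ is *dense* if for all $a,b\in R$ with $b\ne 0$ there is $r\in R$ with $ra\in I$ and $rb\neq 0$; dense right ideals are defined symmetrically. Let $Q^\sigma_{\max}(R)$ be the maximal symmetric ring of quotients of $R$, i.e. the ring of equivalence classes of pairs $(f,g)$, where $f\colon I\to R$ is a homomorphism of left $R$-modules on a dense left ideal $I$, $g\colon J\to R$ is a homomorphism of right $R$-modules on a dense right ideal $J$, and $f(i)j=ig(j)$ for all $i\in I$, $j\in J$; two pairs are equivalent if their first components agree on some dense left ideal and their second components agree on some dense right ideal; the product of $(f,g)$ and $(h,k)$ is $(h\circ f,\ g\circ k)$ where these composites are defined; and $R\to Q^\sigma_{\max}(R)$ sends $r$ to the pair (right multiplication by $r$, left multiplication by $r$), by which $R$ is regarded as a subring. Let $Q^\sigma_{\mathrm{tot}}(R)$ be the total symmetric ring of quotients of $R$, i.e. the join in $Q^\sigma_{\max}(R)$ of all subrings $T\supseteq R$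 for which the inclusion $R\to T$ makes $T$ a perfect symmetric ring of quotients of $R$. For a ring $S$ with $R\subseteq S\subseteq Q^\sigma_{\max}(R)$ put $$S'=\{s\in S \mid S\,(R:rs)=S \text{ and } (sr:R)\,S=S \text{ for every } r\in R\},$$ where $(R:q)=\{x\in R\mid xq\in R\}$ and $(q:R)=\{x\in R\mid qx\in R\}$; this is again a ring between $R$ and $S$. Define $S^{(0)}=S$, $S^{(\alpha+1)}=(S^{(\alpha)})'$, and $S^{(\alpha)}=\bigcap_{\beta<\alpha}S^{(\beta)}$ for a limit ordinal $\alpha$. **Theorem.** There is an ordinal $\gamma$ with $Q^\sigma_{\max}(R)^{(\gamma)}=Q^\sigma_{\max}(R)^{(\gamma+1)}$. For every such $\gamma$, $$Q^\sigma_{\max}(R)^{(\gamma)}=Q^\sigma_{\mathrm{tot}}(R),$$ and the inclusion $f\colon R\to Q^\sigma_{\max}(R)^{(\gamma)}$ has the universal property of the total symmetric ring of quotients: $f$ is an injective ring epimorphism making its target left and right $R$-flat, and for every injective ring epimorphism $g\colon R\to T$ with $T$ left and right $R$-flat there is a unique injective ring homomorphism $\bar g\colon T\to Q^\sigma_{\max}(R)^{(\gamma)}$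 with $f=\bar g g$. -/

import Mathlib

open scoped TensorProduct

universe u

namespace SymQuot

/-! ### Tensor products and flatness over a (noncommutative) ring

Right `R`-modules are `Rᵐᵒᵖ`-modules: `m · r` is `MulOpposite.op r • m`. -/

section Flat

variable (R : Type u) [Ring R]

/-- The relations `(m · r) ⊗ n - m ⊗ (r n)` defining `M ⊗_R N` as a quotient of `M ⊗_ℤ N`. -/
def balancedRel (M N : Type u) [AddCommGroup M] [Module Rᵐᵒᵖ M] [AddCommGroup N] [Module R N] :
    AddSubgroup (M ⊗[ℤ] N) :=
  AddSubgroup.closure {t | ∃ (m : M) (r : R) (n : N),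
    t = (MulOpposite.op r • m) ⊗ₜ[ℤ] n - m ⊗ₜ[ℤ] (r • n)}

/-- The abelian group `M ⊗_R N`, for a right `R`-module `M` and a left `R`-module `N`. -/
abbrev BalTensor (M N : Type u) [AddCommGroup M] [Module Rᵐᵒᵖ M] [AddCommGroup N] [Module R N] :
    Type u :=
  (M ⊗[ℤ] N) ⧸ balancedRel R M N

/-- The homomorphism `f ⊗ g : M ⊗_R N → M' ⊗_R N'`. -/
def BalTensor.map {M M' N N' : Type u}
    [AddCommGroup M] [Module Rᵐᵒᵖ M] [AddCommGroup M'] [Module Rᵐᵒᵖ M']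
    [AddCommGroup N] [Module R N] [AddCommGroup N'] [Module R N']
    (f : M →ₗ[Rᵐᵒᵖ] M') (g : N →ₗ[R] N') : BalTensor R M N →+ BalTensor R M' N' :=
  QuotientAddGroup.map (balancedRel R M N) (balancedRel R M' N')
    (TensorProduct.map f.toAddMonoidHom.toIntLinearMap
      g.toAddMonoidHom.toIntLinearMap).toAddMonoidHom
    (by
      refine (AddSubgroup.closure_le _).2 ?_
      rintro _ ⟨m, r, n, rfl⟩
      refine AddSubgroup.subset_closure ⟨f m, r, g n, ?_⟩
      simp)

/-- A left `R`-module `N` is flat: `- ⊗_R N` preserves injectivity. -/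
def LeftFlat (N : Type u) [AddCommGroup N] [Module R N] : Prop :=
  ∀ (M M' : Type u) [AddCommGroup M] [Module Rᵐᵒᵖ M] [AddCommGroup M'] [Module Rᵐᵒᵖ M']
    (i : M →ₗ[Rᵐᵒᵖ] M'), Function.Injective i →
      Function.Injective (BalTensor.map R i (LinearMap.id : N →ₗ[R] N))

/-- A right `R`-module `M` is flat: `M ⊗_R -` preserves injectivity. -/
def RightFlat (M : Type u) [AddCommGroup M] [Module Rᵐᵒᵖ M] : Prop :=
  ∀ (N N' : Type u) [AddCommGroup N] [Module R N] [AddCommGroup N'] [Module R N']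
    (i : N →ₗ[R] N'), Function.Injective i →
      Function.Injective (BalTensor.map R (LinearMap.id : M →ₗ[Rᵐᵒᵖ] M) i)

end Flat

/-! ### Perfect and total symmetric rings of quotients -/

section Perfect

variable {R S : Type u} [Ring R] [Ring S]

/-- `f : R → S` makes `S` into a perfect symmetric ring of quotients of `R`: it is a ring
epimorphism, and `S` is flat as a left and as a right `R`-module through `f`. -/
structure IsPerfectSymmetric (f : R →+* S) : Prop where
  epi : CategoryTheory.Epi (RingCat.ofHom f)
  leftFlat : letI : Module R S := Module.compHom S f
    LeftFlat R S
  rightFlat : letI : Module Rᵐᵒᵖ S := Module.compHom S f.op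
    RightFlat R S

/-- The universal property of the total symmetric ring of quotients `f : R → S` of `R`: it is the
largest among the injective ring epimorphisms out of `R` with left and right flat target. -/
structure IsTotalSymmetric (f : R →+* S) : Prop where
  injective : Function.Injective f
  perfect : IsPerfectSymmetric f
  universal : ∀ (T : Type u) [Ring T] (g : R →+* T), Function.Injective g →
    IsPerfectSymmetric g → ∃! h : T →+* S, Function.Injective h ∧ h.comp g = f

end Perfect

/-! ### The symmetric Morita operation inside an extension `ι : R → Q` -/

section Morita

variable {R Q : Type u} [Ring R] [Ring Q] (ι : R →+* Q)

/-- The intermediate rings `R ⊆ S ⊆ Q`. -/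
abbrev Intermediate : Type u := {S : Subring Q // ι.range ≤ S}

/-- The inclusion `R → S` for an intermediate ring `S`. -/
def Intermediate.incl (S : Intermediate ι) : R →+* S.1 :=
  ι.codRestrict S.1 fun r => S.2 ⟨r, rfl⟩

variable {ι}

/-- `(R : q) = {x ∈ R | x q ∈ R}`, as a subset of `R`. -/
def leftColon (ι : R →+* Q) (q : Q) : Set R := {x | ι x * q ∈ ι.range}

/-- `(q : R) = {x ∈ R | q x ∈ R}`, as a subset of `R`. -/
def rightColon (ι : R →+* Q) (q : Q) : Set R := {x | q * ι x ∈ ι.range}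

/-- `S A`: the finite sums of products `s a` with `s ∈ S`, `a ∈ A`. -/
def Intermediate.leftMul (S : Intermediate ι) (A : Set R) : AddSubgroup Q :=
  AddSubgroup.closure {y | ∃ s ∈ S.1, ∃ a ∈ A, y = s * ι a}

/-- `A S`: the finite sums of products `a s` with `a ∈ A`, `s ∈ S`. -/
def Intermediate.rightMul (A : Set R) (S : Intermediate ι) : AddSubgroup Q :=
  AddSubgroup.closure {y | ∃ a ∈ A, ∃ s ∈ S.1, y = ι a * s}


theorem Intermediate.mem_of_range (S : Intermediate ι) (r : R) : ι r ∈ S.1 := S.2 ⟨r, rfl⟩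

theorem Intermediate.smul_mem_leftMul (S : Intermediate ι) {A : Set R} {s y : Q} (hs : s ∈ S.1)
    (hy : y ∈ S.leftMul A) : s * y ∈ S.leftMul A := by
  induction hy using AddSubgroup.closure_induction with
  | mem x hx =>
    obtain ⟨t, ht, a, ha, rfl⟩ := hx
    exact AddSubgroup.subset_closure ⟨s * t, mul_mem hs ht, a, ha, (mul_assoc _ _ _).symm⟩
  | zero => simp
  | add x y _ _ hx hy => rw [mul_add]; exact add_mem hx hy
  | neg x _ hx => rw [mul_neg]; exact neg_mem hx

theorem Intermediate.smul_mem_rightMul (S : Intermediate ι) {A : Set R} {s y : Q} (hs : s ∈ S.1)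
    (hy : y ∈ rightMul A S) : y * s ∈ rightMul A S := by
  induction hy using AddSubgroup.closure_induction with
  | mem x hx =>
    obtain ⟨a, ha, t, ht, rfl⟩ := hx
    exact AddSubgroup.subset_closure ⟨a, ha, t * s, mul_mem ht hs, mul_assoc _ _ _⟩
  | zero => simp
  | add x y _ _ hx hy => rw [add_mul]; exact add_mem hx hy
  | neg x _ hx => rw [neg_mul]; exact neg_mem hx

theorem Intermediate.leftMul_eq_iff (S : Intermediate ι) (A : Set R) :
    S.leftMul A = S.1.toAddSubgroup ↔ (1 : Q) ∈ S.leftMul A := by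
  refine ⟨fun h => h ▸ S.1.one_mem, fun h => le_antisymm ((AddSubgroup.closure_le _).2 ?_) ?_⟩
  · rintro _ ⟨s, hs, a, _, rfl⟩
    exact S.1.mul_mem hs (S.mem_of_range a)
  · intro s hs
    simpa using S.smul_mem_leftMul hs h

theorem Intermediate.rightMul_eq_iff (S : Intermediate ι) (A : Set R) :
    rightMul A S = S.1.toAddSubgroup ↔ (1 : Q) ∈ rightMul A S := by
  refine ⟨fun h => h ▸ S.1.one_mem, fun h => le_antisymm ((AddSubgroup.closure_le _).2 ?_) ?_⟩
  · rintro _ ⟨a, _, s, hs, rfl⟩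
    exact S.1.mul_mem (S.mem_of_range a) hs
  · intro s hs
    simpa using S.smul_mem_rightMul hs h

/-- If `S A = S` and for every `a ∈ A` there is `B` with `S B = S` and `B a ⊆ C`, then `S C = S`. -/
theorem Intermediate.leftMul_trans (S : Intermediate ι) {A C : Set R}
    (hA : S.leftMul A = S.1.toAddSubgroup)
    (h : ∀ a ∈ A, ∃ B : Set R, S.leftMul B = S.1.toAddSubgroup ∧ ∀ b ∈ B, b * a ∈ C) :
    S.leftMul C = S.1.toAddSubgroup := by
  rw [leftMul_eq_iff] at hA ⊢
  refine (AddSubgroup.closure_le _).2 ?_ hA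
  rintro _ ⟨s, hs, a, ha, rfl⟩
  obtain ⟨B, hB, hBC⟩ := h a ha
  rw [leftMul_eq_iff] at hB
  have key : ∀ y ∈ S.leftMul B, y * ι a ∈ S.leftMul C := by
    intro y hy
    induction hy using AddSubgroup.closure_induction with
    | mem x hx =>
      obtain ⟨t, ht, b, hb, rfl⟩ := hx
      exact AddSubgroup.subset_closure ⟨t, ht, b * a, hBC b hb, by rw [map_mul, mul_assoc]⟩
    | zero => simp
    | add x y _ _ hx hy => rw [add_mul]; exact add_mem hx hy
    | neg x _ hx => rw [neg_mul]; exact neg_mem hx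
  exact S.smul_mem_leftMul hs (by simpa using key 1 hB)

/-- If `A S = S` and for every `a ∈ A` there is `B` with `B S = S` and `a B ⊆ C`, then `C S = S`. -/
theorem Intermediate.rightMul_trans (S : Intermediate ι) {A C : Set R}
    (hA : rightMul A S = S.1.toAddSubgroup)
    (h : ∀ a ∈ A, ∃ B : Set R, rightMul B S = S.1.toAddSubgroup ∧ ∀ b ∈ B, a * b ∈ C) :
    rightMul C S = S.1.toAddSubgroup := by
  rw [rightMul_eq_iff] at hA ⊢
  refine (AddSubgroup.closure_le _).2 ?_ hA
  rintro _ ⟨a, ha, s, hs, rfl⟩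
  obtain ⟨B, hB, hBC⟩ := h a ha
  rw [rightMul_eq_iff] at hB
  have key : ∀ y ∈ rightMul B S, ι a * y ∈ rightMul C S := by
    intro y hy
    induction hy using AddSubgroup.closure_induction with
    | mem x hx =>
      obtain ⟨b, hb, t, ht, rfl⟩ := hx
      exact AddSubgroup.subset_closure ⟨a * b, hBC b hb, t, ht, by rw [map_mul, mul_assoc]⟩
    | zero => simp
    | add x y _ _ hx hy => rw [mul_add]; exact add_mem hx hy
    | neg x _ hx => rw [mul_neg]; exact neg_mem hx
  exact S.smul_mem_rightMul hs (by simpa using key 1 hB)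

/-- The defining condition of `S'`: `S (R : r s) = S` and `(s r : R) S = S` for every `r ∈ R`. -/
def MoritaCond (S : Intermediate ι) (s : Q) : Prop :=
  ∀ r : R, S.leftMul (leftColon ι (ι r * s)) = S.1.toAddSubgroup ∧
    Intermediate.rightMul (rightColon ι (s * ι r)) S = S.1.toAddSubgroup

theorem moritaCond_of_range (S : Intermediate ι) (x : R) : MoritaCond S (ι x) := by
  intro r
  rw [Intermediate.leftMul_eq_iff, Intermediate.rightMul_eq_iff]
  exact ⟨AddSubgroup.subset_closure ⟨1, S.1.one_mem, 1, ⟨r * x, by simp⟩, by simp⟩,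
    AddSubgroup.subset_closure ⟨1, ⟨x * r, by simp⟩, 1, S.1.one_mem, by simp⟩⟩

theorem MoritaCond.add {S : Intermediate ι} {s t : Q} (hs : MoritaCond S s)
    (ht : MoritaCond S t) : MoritaCond S (s + t) := by
  refine fun r => ⟨S.leftMul_trans (hs r).1 fun a ha => ⟨_, (ht (a * r)).1, fun b hb => ?_⟩,
    S.rightMul_trans (hs r).2 fun a ha => ⟨_, (ht (r * a)).2, fun b hb => ?_⟩⟩
  · have h := ι.range.add_mem (ι.range.mul_mem ⟨b, rfl⟩ ha) hb
    simpa [leftColon, mul_add, mul_assoc] using h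
  · have h := ι.range.add_mem (ι.range.mul_mem ha ⟨b, rfl⟩) hb
    simpa [rightColon, add_mul, mul_assoc] using h

theorem MoritaCond.neg {S : Intermediate ι} {s : Q} (hs : MoritaCond S s) :
    MoritaCond S (-s) := by
  intro r
  simpa [leftColon, rightColon, neg_mem_iff] using hs r

theorem MoritaCond.mul {S : Intermediate ι} {s t : Q} (hs : MoritaCond S s)
    (ht : MoritaCond S t) : MoritaCond S (s * t) := by
  refine fun r => ⟨S.leftMul_trans (hs r).1 fun a ha => ?_,
    S.rightMul_trans (ht r).2 fun a ha => ?_⟩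
  · obtain ⟨c, hc⟩ := ha
    refine ⟨_, (ht c).1, fun b hb => ?_⟩
    simpa [leftColon, hc, mul_assoc] using hb
  · obtain ⟨c, hc⟩ := ha
    refine ⟨_, (hs c).2, fun b hb => ?_⟩
    simpa [rightColon, hc, mul_assoc] using hb

/-- The symmetric Morita operation
`S' = {s ∈ S | S (R : r s) = S and (s r : R) S = S for every r ∈ R}`. -/
def morita (S : Intermediate ι) : Intermediate ι where
  val :=
    { carrier := {s | s ∈ S.1 ∧ MoritaCond S s}
      mul_mem' := fun h k => ⟨S.1.mul_mem h.1 k.1, h.2.mul k.2⟩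
      one_mem' := ⟨S.1.one_mem, by simpa using moritaCond_of_range S 1⟩
      add_mem' := fun h k => ⟨S.1.add_mem h.1 k.1, h.2.add k.2⟩
      zero_mem' := ⟨S.1.zero_mem, by simpa using moritaCond_of_range S 0⟩
      neg_mem' := fun h => ⟨S.1.neg_mem h.1, h.2.neg⟩ }
  property := by
    rintro _ ⟨x, rfl⟩
    exact ⟨S.mem_of_range x, moritaCond_of_range S x⟩

/-- The transfinite sequence `S^(0) = S`, `S^(α+1) = (S^(α))'`, and
`S^(α) = ⋂_{β < α} S^(β)` for a limit ordinal `α`. -/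
noncomputable def moritaIter (S : Intermediate ι) (α : Ordinal.{u}) : Intermediate ι :=
  Ordinal.limitRecOn α S (fun _ T => morita T)
    (fun α _ T => ⟨⨅ β, ⨅ h : β < α, (T β h).1, le_iInf fun β => le_iInf fun h => (T β h).2⟩)

end Morita

/-! ### The maximal symmetric ring of quotients

Left ideals are `Ideal R`, right ideals are `Submodule Rᵐᵒᵖ R`. -/

section Max

variable {R : Type u} [Ring R]

/-- A dense left ideal `I`: for all `a, b ∈ R` with `b ≠ 0` there is `r ∈ R` with
`r a ∈ I` and `r b ≠ 0`. -/
def DenseLeft (I : Ideal R) : Prop := ∀ a b : R, b ≠ 0 → ∃ r : R, r * a ∈ I ∧ r * b ≠ 0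

/-- A dense right ideal `J`: for all `a, b ∈ R` with `b ≠ 0` there is `r ∈ R` with
`a r ∈ J` and `b r ≠ 0`. -/
def DenseRight (J : Submodule Rᵐᵒᵖ R) : Prop := ∀ a b : R, b ≠ 0 → ∃ r : R, a * r ∈ J ∧ b * r ≠ 0

variable (R) in
/-- A compatible pair: a left linear `f : I → R` on a dense left ideal and a right linear
`g : J → R` on a dense right ideal such that `f(i) j = i g(j)`. -/
structure CompatiblePair where
  I : Ideal R
  J : Submodule Rᵐᵒᵖ R
  denseI : DenseLeft I
  denseJ : DenseRight J
  f : I →ₗ[R] R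
  g : J →ₗ[Rᵐᵒᵖ] R
  compat : ∀ (i : I) (j : J), f i * j = i * g j

/-- `(f, g) ∼ (h, k)`: `f`, `h` agree on a dense left ideal and `g`, `k` agree on a dense right
ideal. -/
def CompatiblePair.Rel (p q : CompatiblePair R) : Prop :=
  (∃ I : Ideal R, DenseLeft I ∧ ∃ (hp : I ≤ p.I) (hq : I ≤ q.I), ∀ x (hx : x ∈ I),
      p.f ⟨x, hp hx⟩ = q.f ⟨x, hq hx⟩) ∧
  (∃ J : Submodule Rᵐᵒᵖ R, DenseRight J ∧ ∃ (hp : J ≤ p.J) (hq : J ≤ q.J), ∀ x (hx : x ∈ J),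
      p.g ⟨x, hp hx⟩ = q.g ⟨x, hq hx⟩)

theorem DenseLeft.inf {I I' : Ideal R} (h : DenseLeft I) (h' : DenseLeft I') :
    DenseLeft (I ⊓ I') := by
  intro a b hb
  obtain ⟨r, hr, hrb⟩ := h a b hb
  obtain ⟨t, ht, htb⟩ := h' (r * a) (r * b) hrb
  exact ⟨t * r, by rw [mul_assoc]; exact ⟨I.mul_mem_left t hr, ht⟩, by rwa [mul_assoc]⟩

theorem mul_mem_right_ideal {J : Submodule Rᵐᵒᵖ R} {x : R} (hx : x ∈ J) (t : R) : x * t ∈ J :=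
  J.smul_mem (MulOpposite.op t) hx

theorem DenseRight.inf {J J' : Submodule Rᵐᵒᵖ R} (h : DenseRight J) (h' : DenseRight J') :
    DenseRight (J ⊓ J') := by
  intro a b hb
  obtain ⟨r, hr, hrb⟩ := h a b hb
  obtain ⟨t, ht, htb⟩ := h' (a * r) (b * r) hrb
  exact ⟨r * t, by rw [← mul_assoc]; exact ⟨mul_mem_right_ideal hr t, ht⟩, by rwa [← mul_assoc]⟩

namespace CompatiblePair

theorem f_mul (p : CompatiblePair R) (r x : R) (hx : x ∈ p.I) :
    p.f ⟨r * x, p.I.mul_mem_left r hx⟩ = r * p.f ⟨x, hx⟩ :=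
  p.f.map_smul r ⟨x, hx⟩

theorem g_mul (p : CompatiblePair R) (r x : R) (hx : x ∈ p.J) :
    p.g ⟨x * r, mul_mem_right_ideal hx r⟩ = p.g ⟨x, hx⟩ * r :=
  p.g.map_smul (MulOpposite.op r) ⟨x, hx⟩

theorem f_congr (p : CompatiblePair R) {x y : R} (h : x = y) (hx : x ∈ p.I) (hy : y ∈ p.I) :
    p.f ⟨x, hx⟩ = p.f ⟨y, hy⟩ := by
  subst h; rfl

/-- Equivalence of pairs can be tested on the left components, on the whole common domain. -/
theorem rel_iff (p q : CompatiblePair R) :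
    p.Rel q ↔ ∀ x (hp : x ∈ p.I) (hq : x ∈ q.I), p.f ⟨x, hp⟩ = q.f ⟨x, hq⟩ := by
  constructor
  · rintro ⟨⟨D, hD, hDp, hDq, h⟩, -⟩ x hp hq
    by_contra hne
    obtain ⟨r, hr, hrb⟩ := hD x _ (sub_ne_zero.2 hne)
    apply hrb
    rw [mul_sub, ← f_mul, ← f_mul, sub_eq_zero]
    exact h _ hr
  · intro h
    refine ⟨⟨p.I ⊓ q.I, p.denseI.inf q.denseI, inf_le_left, inf_le_right,
      fun x hx => h x hx.1 hx.2⟩, ⟨p.J ⊓ q.J, p.denseJ.inf q.denseJ, inf_le_left, inf_le_right,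
      fun x hx => ?_⟩⟩
    by_contra hne
    obtain ⟨r, hr, hrb⟩ := (p.denseI.inf q.denseI) 1 _ (sub_ne_zero.2 hne)
    rw [mul_one] at hr
    apply hrb
    have h1 := p.compat ⟨r, hr.1⟩ ⟨x, hx.1⟩
    have h2 := q.compat ⟨r, hr.2⟩ ⟨x, hx.2⟩
    simp only at h1 h2
    rw [mul_sub, ← h1, ← h2, h r hr.1 hr.2, sub_self]

variable (R) in
instance setoid : Setoid (CompatiblePair R) where
  r := Rel
  iseqv :=
    { refl := fun p => (rel_iff p p).2 fun _ _ _ => rfl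
      symm := fun {p q} h => (rel_iff q p).2 fun x hq hp => ((rel_iff p q).1 h x hp hq).symm
      trans := by
        rintro p q t ⟨⟨I, hI, h1, h2, h⟩, ⟨J, hJ, k1, k2, k⟩⟩
          ⟨⟨I', hI', h1', h2', h'⟩, ⟨J', hJ', k1', k2', k'⟩⟩
        exact ⟨⟨I ⊓ I', hI.inf hI', inf_le_left.trans h1, inf_le_right.trans h2',
            fun x hx => (h x hx.1).trans (h' x hx.2)⟩,
          ⟨J ⊓ J', hJ.inf hJ', inf_le_left.trans k1, inf_le_right.trans k2',
            fun x hx => (k x hx.1).trans (k' x hx.2)⟩⟩ }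

/-- The pair `(x ↦ x r, x ↦ r x)` on `R`. -/
def ofRing (r : R) : CompatiblePair R where
  I := ⊤
  J := ⊤
  denseI := fun _ _ hb => ⟨1, trivial, by simpa using hb⟩
  denseJ := fun _ _ hb => ⟨1, trivial, by simpa using hb⟩
  f := { toFun := fun x => x * r
         map_add' := fun x y => add_mul _ _ _
         map_smul' := fun c x => mul_assoc _ _ _ }
  g := { toFun := fun x => r * x
         map_add' := fun x y => mul_add _ _ _
         map_smul' := fun c x => (mul_assoc _ _ _).symm }
  compat := fun i j => mul_assoc _ _ _

/-- Sum of pairs. -/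
def add (p q : CompatiblePair R) : CompatiblePair R where
  I := p.I ⊓ q.I
  J := p.J ⊓ q.J
  denseI := p.denseI.inf q.denseI
  denseJ := p.denseJ.inf q.denseJ
  f := p.f ∘ₗ Submodule.inclusion inf_le_left + q.f ∘ₗ Submodule.inclusion inf_le_right
  g := p.g ∘ₗ Submodule.inclusion inf_le_left + q.g ∘ₗ Submodule.inclusion inf_le_right
  compat := fun i j => by
    have h1 := p.compat ⟨i.1, i.2.1⟩ ⟨j.1, j.2.1⟩
    have h2 := q.compat ⟨i.1, i.2.2⟩ ⟨j.1, j.2.2⟩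
    exact (add_mul _ _ _).trans ((congrArg₂ (· + ·) h1 h2).trans (mul_add _ _ _).symm)

/-- Negative of a pair. -/
def neg (p : CompatiblePair R) : CompatiblePair R where
  I := p.I
  J := p.J
  denseI := p.denseI
  denseJ := p.denseJ
  f := -p.f
  g := -p.g
  compat := fun i j => by simp [p.compat i j]

/-- Product of pairs: `f_q ∘ f_p` and `g_p ∘ g_q`, wherever these composites are defined. -/
def mul (p q : CompatiblePair R) : CompatiblePair R where
  I :=
    { carrier := {x | ∃ h : x ∈ p.I, p.f ⟨x, h⟩ ∈ q.I}
      add_mem' := by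
        rintro x y ⟨hx, hx'⟩ ⟨hy, hy'⟩
        exact ⟨p.I.add_mem hx hy, by
          have := q.I.add_mem hx' hy'
          rwa [← map_add] at this⟩
      zero_mem' := ⟨p.I.zero_mem, by
        have h : p.f ⟨0, p.I.zero_mem⟩ = 0 := map_zero p.f
        rw [h]; exact q.I.zero_mem⟩
      smul_mem' := by
        rintro r x ⟨hx, hx'⟩
        exact ⟨p.I.mul_mem_left r hx, by
          have := q.I.mul_mem_left r hx'
          rwa [← f_mul] at this⟩ }
  J :=
    { carrier := {x | ∃ h : x ∈ q.J, q.g ⟨x, h⟩ ∈ p.J}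
      add_mem' := by
        rintro x y ⟨hx, hx'⟩ ⟨hy, hy'⟩
        exact ⟨q.J.add_mem hx hy, by
          have := p.J.add_mem hx' hy'
          rwa [← map_add] at this⟩
      zero_mem' := ⟨q.J.zero_mem, by
        have h : q.g ⟨0, q.J.zero_mem⟩ = 0 := map_zero q.g
        rw [h]; exact p.J.zero_mem⟩
      smul_mem' := by
        rintro r x ⟨hx, hx'⟩
        exact ⟨q.J.smul_mem r hx, by
          have := p.J.smul_mem r hx'
          rwa [← map_smul] at this⟩ }
  denseI := by
    intro a b hb
    obtain ⟨r, hr, hrb⟩ := p.denseI a b hb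
    obtain ⟨t, ht, htb⟩ := q.denseI (p.f ⟨r * a, hr⟩) (r * b) hrb
    refine ⟨t * r, ?_, by rwa [mul_assoc]⟩
    rw [mul_assoc]
    exact ⟨p.I.mul_mem_left t hr, by rwa [f_mul]⟩
  denseJ := by
    intro a b hb
    obtain ⟨r, hr, hrb⟩ := q.denseJ a b hb
    obtain ⟨t, ht, htb⟩ := p.denseJ (q.g ⟨a * r, hr⟩) (b * r) hrb
    refine ⟨r * t, ?_, by rwa [← mul_assoc]⟩
    rw [← mul_assoc]
    exact ⟨mul_mem_right_ideal hr t, by rwa [g_mul]⟩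
  f :=
    { toFun := fun x => q.f ⟨p.f ⟨x.1, x.2.1⟩, x.2.2⟩
      map_add' := fun x y => by
        rw [← map_add]
        exact q.f_congr (map_add p.f ⟨x.1, x.2.1⟩ ⟨y.1, y.2.1⟩) _ _
      map_smul' := fun r x => by
        rw [← map_smul]
        exact q.f_congr (p.f_mul r x.1 x.2.1) _ _ }
  g :=
    { toFun := fun x => p.g ⟨q.g ⟨x.1, x.2.1⟩, x.2.2⟩
      map_add' := fun x y => by
        rw [← map_add]
        exact congrArg p.g (Subtype.ext (map_add q.g ⟨x.1, x.2.1⟩ ⟨y.1, y.2.1⟩))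
      map_smul' := fun r x => by
        rw [← map_smul]
        exact congrArg p.g (Subtype.ext (map_smul q.g r ⟨x.1, x.2.1⟩)) }
  compat := fun i j =>
    (q.compat ⟨p.f ⟨i.1, i.2.1⟩, i.2.2⟩ ⟨j.1, j.2.1⟩).trans
      (p.compat ⟨i.1, i.2.1⟩ ⟨q.g ⟨j.1, j.2.1⟩, j.2.2⟩)

end CompatiblePair

variable (R) in
/-- The maximal symmetric ring of quotients of `R`: the symmetric ring of quotients with respect
to the filters of all dense left and all dense right ideals. -/
def MaxSym : Type u := Quotient (CompatiblePair.setoid R)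

namespace MaxSym

open CompatiblePair

theorem sound {p q : CompatiblePair R}
    (h : ∀ x (hp : x ∈ p.I) (hq : x ∈ q.I), p.f ⟨x, hp⟩ = q.f ⟨x, hq⟩) :
    (Quotient.mk (setoid R) p : MaxSym R) = Quotient.mk (setoid R) q :=
  Quotient.sound ((rel_iff p q).2 h)

instance : Add (MaxSym R) :=
  ⟨Quotient.map₂ CompatiblePair.add fun p p' h q q' k => (rel_iff _ _).2 fun x hp hq =>
    congrArg₂ (· + ·) ((rel_iff p p').1 h x hp.1 hq.1) ((rel_iff q q').1 k x hp.2 hq.2)⟩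

instance : Neg (MaxSym R) :=
  ⟨Quotient.map CompatiblePair.neg fun p p' h => (rel_iff _ _).2 fun x hp hq =>
    congrArg (- ·) ((rel_iff p p').1 h x hp hq)⟩

instance : Mul (MaxSym R) :=
  ⟨Quotient.map₂ CompatiblePair.mul fun p p' h q q' k => (rel_iff _ _).2 fun x hp hq => by
    have e := (rel_iff p p').1 h x hp.1 hq.1
    have hm : p.f ⟨x, hp.1⟩ ∈ q'.I := by rw [e]; exact hq.2
    exact ((rel_iff q q').1 k _ hp.2 hm).trans (q'.f_congr e _ _)⟩

instance : Zero (MaxSym R) := ⟨Quotient.mk (setoid R) (ofRing 0)⟩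

instance : One (MaxSym R) := ⟨Quotient.mk (setoid R) (ofRing 1)⟩

theorem f_add (p : CompatiblePair R) {x y : R} (hx : x ∈ p.I) (hy : y ∈ p.I)
    (h : x + y ∈ p.I) : p.f ⟨x + y, h⟩ = p.f ⟨x, hx⟩ + p.f ⟨y, hy⟩ :=
  map_add p.f ⟨x, hx⟩ ⟨y, hy⟩

instance : Ring (MaxSym R) where
  add_assoc := by
    rintro ⟨p⟩ ⟨q⟩ ⟨t⟩
    exact sound fun x _ _ => add_assoc _ _ _
  zero_add := by
    rintro ⟨p⟩
    exact sound fun x _ hq => (congrArg (· + p.f ⟨x, hq⟩) (mul_zero x)).trans (zero_add _)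
  add_zero := by
    rintro ⟨p⟩
    exact sound fun x _ hq => (congrArg (p.f ⟨x, hq⟩ + ·) (mul_zero x)).trans (add_zero _)
  add_comm := by
    rintro ⟨p⟩ ⟨q⟩
    exact sound fun x _ _ => add_comm _ _
  neg_add_cancel := by
    rintro ⟨p⟩
    exact sound fun x _ _ => (neg_add_cancel _).trans (mul_zero x).symm
  mul_assoc := by
    rintro ⟨p⟩ ⟨q⟩ ⟨t⟩
    exact sound fun x _ _ => rfl
  one_mul := by
    rintro ⟨p⟩
    exact sound fun x _ hq => p.f_congr (mul_one x) _ _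
  mul_one := by
    rintro ⟨p⟩
    exact sound fun x _ _ => mul_one _
  zero_mul := by
    rintro ⟨p⟩
    refine sound fun x hp _ => ?_
    have h : p.f ⟨x * 0, hp.2⟩ = 0 :=
      (p.f_congr (mul_zero x) _ p.I.zero_mem).trans (map_zero p.f)
    exact h.trans (mul_zero x).symm
  mul_zero := by
    rintro ⟨p⟩
    exact sound fun x _ _ => (mul_zero _).trans (mul_zero x).symm
  left_distrib := by
    rintro ⟨p⟩ ⟨q⟩ ⟨t⟩
    exact sound fun x _ _ => rfl
  right_distrib := by
    rintro ⟨p⟩ ⟨q⟩ ⟨t⟩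
    exact sound fun x hp hq => f_add t hq.1.2 hq.2.2 _
  nsmul := nsmulRec
  zsmul := zsmulRec

variable (R) in
/-- The canonical map `R → Q`, sending `r` to the class of `(x ↦ x r, x ↦ r x)`. -/
def of : R →+* MaxSym R where
  toFun r := Quotient.mk (setoid R) (ofRing r)
  map_one' := rfl
  map_zero' := rfl
  map_add' _ _ := sound fun x _ _ => mul_add x _ _
  map_mul' _ _ := sound fun x _ _ => (mul_assoc x _ _).symm

end MaxSym

end Max

/-! ### The total symmetric ring of quotients and the descending sequence -/

section Total

variable (R : Type u) [Ring R]

/-- `R ⊆ Q ⊆ Q`: the maximal symmetric ring of quotients as an intermediate ring of itself. -/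
def maxSymTop : Intermediate (MaxSym.of R) := ⟨⊤, le_top⟩

/-- The total symmetric ring of quotients of `R`: the join, inside the maximal symmetric ring of
quotients, of all intermediate rings `T` such that the inclusion `R → T` makes `T` into a perfect
symmetric ring of quotients. -/
def totSym : Subring (MaxSym R) :=
  sSup {T | ∃ h : (MaxSym.of R).range ≤ T,
    IsPerfectSymmetric (Intermediate.incl (MaxSym.of R) ⟨T, h⟩)}

end Total

end SymQuot

/-!
Call a ring homomorphism `f : R → S` *colon generating* if `S (R : s) = S` and
`(s : R) S = S` for every `s ∈ S` (`ColonGenerating`). The proof rests on the fact that, among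
injective homomorphisms, these are exactly the perfect symmetric rings of quotients.

* If `f` is colon generating, then `S ⊗_R N` embeds into a reduced power of `N`: send `s ⊗ n` to
  the germ of `a ↦ (a s) n` along the filter generated by the left ideals `(R : s)`. An element
  with zero germ is killed by some set `U` with `S U = S`, hence is zero. The embedding is natural
  in `N` and reduced powers preserve injectivity, so `S` is right flat
  (`ColonGenerating.rightFlat`), and symmetrically left flat. Writing `1 = ∑ aᵢ sᵢ` with
  `s aᵢ ∈ R` shows that `f` is an epimorphism (`ColonGenerating.epi`).
* If `f` is an epimorphism, then `1 ⊗ s̄ = 0` in `S ⊗_R S/R` (`one_tmul_eq_of_epi`). As `R/(R : s)`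
  embeds in `S/R` by `1 ↦ s̄`, right flatness gives `S ⊗_R R/(R : s) = 0`, that is,
  `S (R : s) = S` (`IsPerfectSymmetric.colonGenerating`).

An intermediate ring `S` with `S' = S` is colon generating, hence perfect. Conversely, a colon
generating `R → T` maps injectively to the maximal symmetric ring of quotients, `t` acting by
multiplication on `(R : t)` and on `(t : R)` (`toMaxSym`), and if its image lies in `S` then it lies
in `S'`, so it survives every step of the descending sequence
(`ColonGenerating.range_le_moritaIter`). Thus a stationary term of the sequence is perfect and
contains every perfect extension. A stationary term exists because the sequence is antitone and
the ordinals do not inject into a set (`exists_moritaIter_eq`).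
-/

namespace SymQuot

/-! ### Elements and universal property of `M ⊗_R N` -/

section BalTensor

variable {R : Type u} [Ring R] {M M' N N' : Type u}
  [AddCommGroup M] [Module Rᵐᵒᵖ M] [AddCommGroup M'] [Module Rᵐᵒᵖ M']
  [AddCommGroup N] [Module R N] [AddCommGroup N'] [Module R N']

variable (R) in
/-- The pure tensor `m ⊗ n` in `M ⊗_R N`. -/
def BalTensor.tmul (m : M) (n : N) : BalTensor R M N :=
  QuotientAddGroup.mk (m ⊗ₜ[ℤ] n)

namespace BalTensor

theorem add_tmul (m m' : M) (n : N) : tmul R (m + m') n = tmul R m n + tmul R m' n := by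
  simp [tmul, TensorProduct.add_tmul]

theorem tmul_add (m : M) (n n' : N) : tmul R m (n + n') = tmul R m n + tmul R m n' := by
  simp [tmul, TensorProduct.tmul_add]

theorem zero_tmul (n : N) : tmul R (0 : M) n = 0 := by simp [tmul]

theorem tmul_zero (m : M) : tmul R m (0 : N) = 0 := by simp [tmul]

theorem smul_tmul (m : M) (r : R) (n : N) :
    tmul R (MulOpposite.op r • m) n = tmul R m (r • n) := by
  refine QuotientAddGroup.eq_iff_sub_mem.2 (AddSubgroup.subset_closure ⟨m, r, n, rfl⟩)

@[elab_as_elim]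
theorem induction_on {p : BalTensor R M N → Prop} (x : BalTensor R M N) (zero : p 0)
    (tmul : ∀ m n, p (tmul R m n)) (add : ∀ x y, p x → p y → p (x + y)) : p x := by
  induction x using QuotientAddGroup.induction_on with
  | H z =>
    induction z with
    | zero => exact zero
    | tmul m n => exact tmul m n
    | add x y hx hy => exact add _ _ hx hy

theorem addHom_ext {P : Type*} [AddCommGroup P] {φ ψ : BalTensor R M N →+ P}
    (h : ∀ m n, φ (tmul R m n) = ψ (tmul R m n)) : φ = ψ := by
  refine DFunLike.ext _ _ fun x => ?_
  induction x using induction_on with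
  | zero => rw [map_zero, map_zero]
  | tmul m n => exact h m n
  | add x y hx hy => rw [map_add, map_add, hx, hy]

@[simp]
theorem map_tmul (f : M →ₗ[Rᵐᵒᵖ] M') (g : N →ₗ[R] N') (m : M) (n : N) :
    map R f g (tmul R m n) = tmul R (f m) (g n) := rfl

/-- The homomorphism out of `M ⊗_R N` given by a balanced biadditive map. -/
def lift {P : Type*} [AddCommGroup P] (φ : M →+ N →+ P)
    (h : ∀ m (r : R) n, φ (MulOpposite.op r • m) n = φ m (r • n)) : BalTensor R M N →+ P :=
  QuotientAddGroup.lift (balancedRel R M N)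
    (TensorProduct.liftAddHom φ fun z m n => by simp)
    (by
      refine (AddSubgroup.closure_le _).2 ?_
      rintro _ ⟨m, r, n, rfl⟩
      simp [AddMonoidHom.mem_ker, h])

@[simp]
theorem lift_tmul {P : Type*} [AddCommGroup P] (φ : M →+ N →+ P)
    (h : ∀ m (r : R) n, φ (MulOpposite.op r • m) n = φ m (r • n)) (m : M) (n : N) :
    lift φ h (tmul R m n) = φ m n := rfl

end BalTensor

end BalTensor

/-! ### Colons that generate the unit ideal -/

section ColonGenerating

variable {R S : Type u} [Ring R] [Ring S]

/-- The ring `S` as an intermediate ring of `f : R → S`. -/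
def Intermediate.full (f : R →+* S) : Intermediate f := ⟨⊤, le_top⟩

/-- `S (R : s) = S` and `(s : R) S = S` for every `s ∈ S`. -/
def ColonGenerating (f : R →+* S) : Prop :=
  ∀ s : S, (1 : S) ∈ (Intermediate.full f).leftMul (leftColon f s) ∧
    (1 : S) ∈ Intermediate.rightMul (rightColon f s) (Intermediate.full f)

variable {f : R →+* S}

theorem mul_mem_leftColon {s : S} {a : R} (b : R) (ha : a ∈ leftColon f s) :
    b * a ∈ leftColon f s := by
  obtain ⟨c, hc⟩ := ha
  exact ⟨b * c, by rw [map_mul, hc, map_mul, mul_assoc]⟩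

theorem mul_mem_rightColon {s : S} {a : R} (b : R) (ha : a ∈ rightColon f s) :
    a * b ∈ rightColon f s := by
  obtain ⟨c, hc⟩ := ha
  exact ⟨c * b, by rw [map_mul, hc, map_mul, mul_assoc]⟩

theorem add_mem_leftColon {s : S} {a b : R} (ha : a ∈ leftColon f s) (hb : b ∈ leftColon f s) :
    a + b ∈ leftColon f s := by
  obtain ⟨c, hc⟩ := ha
  obtain ⟨d, hd⟩ := hb
  exact ⟨c + d, by rw [map_add, hc, hd, map_add, add_mul]⟩

theorem add_mem_rightColon {s : S} {a b : R} (ha : a ∈ rightColon f s)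
    (hb : b ∈ rightColon f s) : a + b ∈ rightColon f s := by
  obtain ⟨c, hc⟩ := ha
  obtain ⟨d, hd⟩ := hb
  exact ⟨c + d, by rw [map_add, hc, hd, map_add, mul_add]⟩

/-- If `1 ∈ S A`, then `A` detects the vanishing of an element of a left `S`-module; the additive
group `E` with `S` acting through `L` plays the role of the module. -/
theorem eq_zero_of_one_mem_leftMul {E : Type*} [AddCommGroup E] (L : S →+* AddMonoid.End E)
    {A : Set R} (hA : (1 : S) ∈ (Intermediate.full f).leftMul A) {x : E}
    (h : ∀ a ∈ A, L (f a) x = 0) : x = 0 := by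
  suffices ∀ y ∈ (Intermediate.full f).leftMul A, L y x = 0 by simpa using this 1 hA
  intro y hy
  induction hy using AddSubgroup.closure_induction with
  | mem y hy =>
    obtain ⟨s, -, a, ha, rfl⟩ := hy
    rw [map_mul, AddMonoid.End.coe_mul, Function.comp_apply, h a ha, map_zero]
  | zero => rw [map_zero]; rfl
  | add y z _ _ hy hz => rw [map_add]; exact (congrArg₂ (· + ·) hy hz).trans (add_zero 0)
  | neg y _ hy => rw [map_neg]; exact (congrArg (- ·) hy).trans neg_zero

/-- If `1 ∈ A S`, then `A` detects the vanishing of an element of a right `S`-module; the additive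
group `E` with `S` acting through `L` plays the role of the module. -/
theorem eq_zero_of_one_mem_rightMul {E : Type*} [AddCommGroup E] (L : Sᵐᵒᵖ →+* AddMonoid.End E)
    {A : Set R} (hA : (1 : S) ∈ Intermediate.rightMul A (Intermediate.full f)) {x : E}
    (h : ∀ a ∈ A, L (MulOpposite.op (f a)) x = 0) : x = 0 := by
  suffices ∀ y ∈ Intermediate.rightMul A (Intermediate.full f), L (MulOpposite.op y) x = 0 by
    simpa using this 1 hA
  intro y hy
  induction hy using AddSubgroup.closure_induction with
  | mem y hy =>
    obtain ⟨a, ha, s, -, rfl⟩ := hy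
    rw [MulOpposite.op_mul, map_mul, AddMonoid.End.coe_mul, Function.comp_apply, h a ha, map_zero]
  | zero => rw [MulOpposite.op_zero, map_zero]; rfl
  | add y z _ _ hy hz =>
    rw [MulOpposite.op_add, map_add]; exact (congrArg₂ (· + ·) hy hz).trans (add_zero 0)
  | neg y _ hy => rw [MulOpposite.op_neg, map_neg]; exact (congrArg (- ·) hy).trans neg_zero

variable (f) in
/-- The filter on `R` generated by the left ideals `(R : s)`, `s ∈ S`. -/
def leftColonFilter : Filter R := ⨅ s : S, Filter.principal (leftColon f s)

variable (f) in
/-- The filter on `R` generated by the right ideals `(s : R)`, `s ∈ S`. -/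
def rightColonFilter : Filter R := ⨅ s : S, Filter.principal (rightColon f s)

theorem leftColon_mem_filter (s : S) : leftColon f s ∈ leftColonFilter f :=
  Filter.mem_iInf_of_mem s (Filter.mem_principal_self _)

theorem rightColon_mem_filter (s : S) : rightColon f s ∈ rightColonFilter f :=
  Filter.mem_iInf_of_mem s (Filter.mem_principal_self _)

theorem ColonGenerating.one_mem_leftMul (hf : ColonGenerating f) {U : Set R}
    (hU : U ∈ leftColonFilter f) : (1 : S) ∈ (Intermediate.full f).leftMul U := by
  obtain ⟨t, ht, htU⟩ := (Filter.hasBasis_iInf_principal_finite _).mem_iff.1 hU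
  suffices h : (1 : S) ∈ (Intermediate.full f).leftMul (⋂ s ∈ t, leftColon f s) from
    by
      refine AddSubgroup.closure_mono ?_ h
      rintro _ ⟨s, hs, a, ha, e⟩
      exact ⟨s, hs, a, htU ha, e⟩
  clear htU hU
  induction t, ht using Set.Finite.induction_on with
  | empty => exact AddSubgroup.subset_closure ⟨1, trivial, 1, by simp, by simp⟩
  | @insert s t _ _ ih =>
    rw [← Intermediate.leftMul_eq_iff] at ih ⊢
    -- For `a` in the intersection over `t`, the colon of `a s` multiplies `a` into `(R : s)`.
    refine Intermediate.leftMul_trans _ ih fun a ha => ⟨leftColon f (f a * s),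
      (Intermediate.leftMul_eq_iff _ _).2 (hf _).1, fun b hb => ?_⟩
    simp only [Set.mem_iInter, Set.mem_insert_iff, forall_eq_or_imp] at ha ⊢
    exact ⟨by simpa [leftColon, mul_assoc] using hb, fun i hi => mul_mem_leftColon b (ha i hi)⟩

theorem ColonGenerating.one_mem_rightMul (hf : ColonGenerating f) {U : Set R}
    (hU : U ∈ rightColonFilter f) : (1 : S) ∈ Intermediate.rightMul U (Intermediate.full f) := by
  obtain ⟨t, ht, htU⟩ := (Filter.hasBasis_iInf_principal_finite _).mem_iff.1 hU
  suffices h : (1 : S) ∈ Intermediate.rightMul (⋂ s ∈ t, rightColon f s) (Intermediate.full f) from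
    by
      refine AddSubgroup.closure_mono ?_ h
      rintro _ ⟨a, ha, s, hs, e⟩
      exact ⟨a, htU ha, s, hs, e⟩
  clear htU hU
  induction t, ht using Set.Finite.induction_on with
  | empty => exact AddSubgroup.subset_closure ⟨1, by simp, 1, trivial, by simp⟩
  | @insert s t _ _ ih =>
    rw [← Intermediate.rightMul_eq_iff] at ih ⊢
    refine Intermediate.rightMul_trans _ ih fun a ha => ⟨rightColon f (s * f a),
      (Intermediate.rightMul_eq_iff _ _).2 (hf _).2, fun b hb => ?_⟩
    simp only [Set.mem_iInter, Set.mem_insert_iff, forall_eq_or_imp] at ha ⊢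
    exact ⟨by simpa [rightColon, mul_assoc] using hb, fun i hi => mul_mem_rightColon b (ha i hi)⟩

end ColonGenerating

/-! ### Generating colons give flatness -/

section Flatness

open MulOpposite

variable {R S : Type u} [Ring R] [Ring S] {f : R →+* S}

section Right

/-- A representative in `R` of `f(a) s`, for `a ∈ (R : s)`; it is `0` off `(R : s)`. -/
noncomputable def leftCoeff (f : R →+* S) (s : S) (a : R) : R := by
  classical exact if h : a ∈ leftColon f s then h.choose else 0

theorem map_leftCoeff {s : S} {a : R} (h : a ∈ leftColon f s) : f (leftCoeff f s a) = f a * s := by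
  rw [leftCoeff, dif_pos h]; exact h.choose_spec

theorem leftCoeff_eq (hf : Function.Injective f) {s : S} {a c : R} (h : f c = f a * s) :
    leftCoeff f s a = c :=
  hf ((map_leftCoeff ⟨c, h⟩).trans h.symm)

variable [Module Rᵐᵒᵖ S]

/-- Left multiplication by elements of `S` on `S ⊗_R N`. -/
def leftAct (hS : ∀ (r : R) (s : S), op r • s = s * f r) (N : Type u) [AddCommGroup N]
    [Module R N] : S →+* AddMonoid.End (BalTensor R S N) where
  toFun s := BalTensor.map R
    { toFun := fun t => s * t
      map_add' := mul_add s
      map_smul' := fun r t => by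
        induction r using MulOpposite.rec' with
        | h r => simp [hS, mul_assoc] } LinearMap.id
  map_one' := BalTensor.addHom_ext fun t n => congrArg (BalTensor.tmul R · n) (one_mul t)
  map_zero' := BalTensor.addHom_ext fun t n =>
    (congrArg (BalTensor.tmul R · n) (zero_mul t)).trans (BalTensor.zero_tmul n)
  map_mul' s s' := BalTensor.addHom_ext fun t n =>
    congrArg (BalTensor.tmul R · n) (mul_assoc s s' t)
  map_add' s s' := BalTensor.addHom_ext fun t n =>
    (congrArg (BalTensor.tmul R · n) (add_mul s s' t)).trans (BalTensor.add_tmul _ _ n)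

@[simp]
theorem leftAct_tmul (hS : ∀ (r : R) (s : S), op r • s = s * f r) {N : Type u} [AddCommGroup N]
    [Module R N] (s t : S) (n : N) :
    leftAct hS N s (BalTensor.tmul R t n) = BalTensor.tmul R (s * t) n := rfl

/-- The map `S ⊗_R N → N^R / ∼` sending `s ⊗ n` to the germ of `a ↦ (a s) n`, where functions are
identified if they agree on a finite intersection of ideals `(R : s)`. -/
noncomputable def toGermRight (hinj : Function.Injective f)
    (hS : ∀ (r : R) (s : S), op r • s = s * f r) (N : Type u) [AddCommGroup N] [Module R N] :
    BalTensor R S N →+ Filter.Germ (leftColonFilter f) N :=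
  BalTensor.lift
    { toFun := fun s =>
        { toFun := fun n => ((fun a => leftCoeff f s a • n : R → N) : Filter.Germ _ N)
          map_zero' := by simp only [smul_zero]; rfl
          map_add' := fun n n' => by simp only [smul_add]; rfl }
      map_zero' := by
        ext n
        have h : ∀ a, leftCoeff f 0 a = 0 := fun a => leftCoeff_eq hinj (by simp)
        simp only [AddMonoidHom.coe_mk, ZeroHom.coe_mk, h, zero_smul]; rfl
      map_add' := fun s t => by
        ext n
        refine Filter.Germ.coe_eq.2 ?_
        filter_upwards [leftColon_mem_filter (f := f) s, leftColon_mem_filter (f := f) t]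
          with a hs ht
        change leftCoeff f (s + t) a • n = leftCoeff f s a • n + leftCoeff f t a • n
        rw [← add_smul, leftCoeff_eq hinj]
        rw [map_add, map_leftCoeff hs, map_leftCoeff ht, mul_add] }
    (by
      intro s r n
      refine Filter.Germ.coe_eq.2 ?_
      filter_upwards [leftColon_mem_filter (f := f) s] with a hs
      rw [hS, smul_smul, leftCoeff_eq hinj]
      rw [map_mul, map_leftCoeff hs, mul_assoc])

theorem toGermRight_tmul (hinj : Function.Injective f)
    (hS : ∀ (r : R) (s : S), op r • s = s * f r) {N : Type u} [AddCommGroup N] [Module R N]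
    (s : S) (n : N) :
    toGermRight hinj hS N (BalTensor.tmul R s n) =
      ((fun a => leftCoeff f s a • n : R → N) : Filter.Germ _ N) := rfl

/-- An element `x` of `S ⊗_R N` is represented by a function `φ` such that `a x = 1 ⊗ φ(a)` for
all `a` in a member of the filter. -/
theorem exists_toGermRight_eq (hinj : Function.Injective f)
    (hS : ∀ (r : R) (s : S), op r • s = s * f r) {N : Type u} [AddCommGroup N] [Module R N]
    (x : BalTensor R S N) : ∃ φ : R → N, toGermRight hinj hS N x = (φ : Filter.Germ _ N) ∧
      ∀ᶠ a in leftColonFilter f, leftAct hS N (f a) x = BalTensor.tmul R 1 (φ a) := by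
  induction x using BalTensor.induction_on with
  | zero => exact ⟨0, map_zero _, .of_forall fun a => by
      rw [map_zero]; exact (BalTensor.tmul_zero _).symm⟩
  | tmul s n =>
    refine ⟨_, toGermRight_tmul hinj hS s n, ?_⟩
    filter_upwards [leftColon_mem_filter (f := f) s] with a ha
    rw [leftAct_tmul, ← BalTensor.smul_tmul, hS, map_leftCoeff ha, one_mul]
  | add x y hx hy =>
    obtain ⟨φ, hφ, h⟩ := hx
    obtain ⟨ψ, hψ, k⟩ := hy
    refine ⟨φ + ψ, by rw [map_add, hφ, hψ]; rfl, ?_⟩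
    filter_upwards [h, k] with a ha ka
    rw [map_add, ha, ka, Pi.add_apply, BalTensor.tmul_add]

theorem toGermRight_injective (hinj : Function.Injective f) (hf : ColonGenerating f)
    (hS : ∀ (r : R) (s : S), op r • s = s * f r) (N : Type u) [AddCommGroup N] [Module R N] :
    Function.Injective (toGermRight hinj hS N) := by
  refine (injective_iff_map_eq_zero _).2 fun x hx => ?_
  obtain ⟨φ, hφ, h⟩ := exists_toGermRight_eq hinj hS x
  have h0 : φ =ᶠ[leftColonFilter f] 0 := Filter.Germ.coe_eq.1 (hφ.symm.trans hx)
  refine eq_zero_of_one_mem_leftMul (leftAct hS N) (hf.one_mem_leftMul (h.and h0)) ?_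
  rintro a ⟨ha, ha0⟩
  rw [ha, ha0]
  exact BalTensor.tmul_zero _

theorem toGermRight_map (hinj : Function.Injective f)
    (hS : ∀ (r : R) (s : S), op r • s = s * f r) {N N' : Type u} [AddCommGroup N] [Module R N]
    [AddCommGroup N'] [Module R N'] (i : N →ₗ[R] N') (x : BalTensor R S N) :
    toGermRight hinj hS N' (BalTensor.map R LinearMap.id i x) =
      (toGermRight hinj hS N x).map i := by
  induction x using BalTensor.induction_on with
  | zero =>
    rw [map_zero, map_zero, map_zero]
    exact congrArg Filter.Germ.ofFun (funext fun _ => (map_zero i).symm)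
  | tmul s n =>
    rw [BalTensor.map_tmul, toGermRight_tmul, toGermRight_tmul, Filter.Germ.map_coe]
    exact congrArg Filter.Germ.ofFun (funext fun a => (map_smul i _ _).symm)
  | add x y hx hy =>
    rw [map_add, map_add, hx, hy, map_add]
    generalize toGermRight hinj hS N x = g
    generalize toGermRight hinj hS N y = k
    induction g using Filter.Germ.inductionOn with
    | _ g =>
    induction k using Filter.Germ.inductionOn with
    | _ k =>
    exact congrArg Filter.Germ.ofFun (funext fun a => (map_add i _ _).symm)

/-- `S ⊗_R -` embeds naturally in the functor `N ↦ N^R / ∼`, which preserves injectivity. -/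
theorem ColonGenerating.rightFlat (hinj : Function.Injective f) (hf : ColonGenerating f)
    (hS : ∀ (r : R) (s : S), op r • s = s * f r) : RightFlat R S := by
  intro N N' _ _ _ _ i hi
  refine (injective_iff_map_eq_zero _).2 fun x hx => toGermRight_injective hinj hf hS N ?_
  have h := toGermRight_map hinj hS i x
  rw [hx, map_zero] at h
  rw [map_zero]
  generalize toGermRight hinj hS N x = g at h
  induction g using Filter.Germ.inductionOn with
  | _ g =>
  refine Filter.Germ.coe_eq.2 ?_
  filter_upwards [Filter.Germ.coe_eq.1 h] with a ha
  exact hi (ha.symm.trans (map_zero i).symm)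

end Right

section Left

/-- A representative in `R` of `s f(a)`, for `a ∈ (s : R)`; it is `0` off `(s : R)`. -/
noncomputable def rightCoeff (f : R →+* S) (s : S) (a : R) : R := by
  classical exact if h : a ∈ rightColon f s then h.choose else 0

theorem map_rightCoeff {s : S} {a : R} (h : a ∈ rightColon f s) :
    f (rightCoeff f s a) = s * f a := by
  rw [rightCoeff, dif_pos h]; exact h.choose_spec

theorem rightCoeff_eq (hf : Function.Injective f) {s : S} {a c : R} (h : f c = s * f a) :
    rightCoeff f s a = c :=
  hf ((map_rightCoeff ⟨c, h⟩).trans h.symm)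

variable [Module R S]

/-- Right multiplication by elements of `S` on `M ⊗_R S`. -/
def rightAct (hS : ∀ (r : R) (s : S), r • s = f r * s) (M : Type u) [AddCommGroup M]
    [Module Rᵐᵒᵖ M] : Sᵐᵒᵖ →+* AddMonoid.End (BalTensor R M S) where
  toFun s := BalTensor.map R LinearMap.id
    { toFun := fun t => t * s.unop
      map_add' := fun t t' => add_mul t t' s.unop
      map_smul' := fun r t => by simp [hS, mul_assoc] }
  map_one' := BalTensor.addHom_ext fun m t => congrArg (BalTensor.tmul R m) (mul_one t)
  map_zero' := BalTensor.addHom_ext fun m t =>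
    (congrArg (BalTensor.tmul R m) (mul_zero t)).trans (BalTensor.tmul_zero m)
  map_mul' s s' := BalTensor.addHom_ext fun m t =>
    congrArg (BalTensor.tmul R m) (mul_assoc t s'.unop s.unop).symm
  map_add' s s' := BalTensor.addHom_ext fun m t =>
    (congrArg (BalTensor.tmul R m) (mul_add t s.unop s'.unop)).trans (BalTensor.tmul_add m _ _)

@[simp]
theorem rightAct_tmul (hS : ∀ (r : R) (s : S), r • s = f r * s) {M : Type u} [AddCommGroup M]
    [Module Rᵐᵒᵖ M] (s : Sᵐᵒᵖ) (m : M) (t : S) :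
    rightAct hS M s (BalTensor.tmul R m t) = BalTensor.tmul R m (t * s.unop) := rfl

/-- The map `M ⊗_R S → M^R / ∼` sending `m ⊗ s` to the germ of `a ↦ m (s a)`, where functions are
identified if they agree on a finite intersection of ideals `(s : R)`. -/
noncomputable def toGermLeft (hinj : Function.Injective f)
    (hS : ∀ (r : R) (s : S), r • s = f r * s) (M : Type u) [AddCommGroup M] [Module Rᵐᵒᵖ M] :
    BalTensor R M S →+ Filter.Germ (rightColonFilter f) M :=
  BalTensor.lift
    { toFun := fun m =>
        { toFun := fun s => ((fun a => op (rightCoeff f s a) • m : R → M) : Filter.Germ _ M)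
          map_zero' := by
            have h : ∀ a, rightCoeff f 0 a = 0 := fun a => rightCoeff_eq hinj (by simp)
            simp only [h, op_zero, zero_smul]; rfl
          map_add' := fun s t => by
            refine Filter.Germ.coe_eq.2 ?_
            filter_upwards [rightColon_mem_filter (f := f) s, rightColon_mem_filter (f := f) t]
              with a hs ht
            change op (rightCoeff f (s + t) a) • m =
              op (rightCoeff f s a) • m + op (rightCoeff f t a) • m
            rw [← add_smul, ← op_add, rightCoeff_eq hinj]
            rw [map_add, map_rightCoeff hs, map_rightCoeff ht, add_mul] }
      map_zero' := by
        ext s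
        simp only [AddMonoidHom.coe_mk, ZeroHom.coe_mk, smul_zero]; rfl
      map_add' := fun m m' => by
        ext s
        simp only [AddMonoidHom.coe_mk, ZeroHom.coe_mk, smul_add]; rfl }
    (by
      intro m r s
      refine Filter.Germ.coe_eq.2 ?_
      filter_upwards [rightColon_mem_filter (f := f) s] with a hs
      rw [hS, smul_smul, ← op_mul, rightCoeff_eq (s := f r * s) hinj]
      rw [map_mul, map_rightCoeff hs, mul_assoc])

theorem toGermLeft_tmul (hinj : Function.Injective f)
    (hS : ∀ (r : R) (s : S), r • s = f r * s) {M : Type u} [AddCommGroup M] [Module Rᵐᵒᵖ M]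
    (m : M) (s : S) :
    toGermLeft hinj hS M (BalTensor.tmul R m s) =
      ((fun a => op (rightCoeff f s a) • m : R → M) : Filter.Germ _ M) := rfl

/-- An element `x` of `M ⊗_R S` is represented by a function `φ` such that `x a = φ(a) ⊗ 1` for
all `a` in a member of the filter. -/
theorem exists_toGermLeft_eq (hinj : Function.Injective f)
    (hS : ∀ (r : R) (s : S), r • s = f r * s) {M : Type u} [AddCommGroup M] [Module Rᵐᵒᵖ M]
    (x : BalTensor R M S) : ∃ φ : R → M, toGermLeft hinj hS M x = (φ : Filter.Germ _ M) ∧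
      ∀ᶠ a in rightColonFilter f,
        rightAct hS M (op (f a)) x = BalTensor.tmul R (φ a) 1 := by
  induction x using BalTensor.induction_on with
  | zero => exact ⟨0, map_zero _, .of_forall fun a => by
      rw [map_zero]; exact (BalTensor.zero_tmul _).symm⟩
  | tmul m s =>
    refine ⟨_, toGermLeft_tmul hinj hS m s, ?_⟩
    filter_upwards [rightColon_mem_filter (f := f) s] with a ha
    rw [rightAct_tmul, BalTensor.smul_tmul, hS, map_rightCoeff ha, mul_one, unop_op]
  | add x y hx hy =>
    obtain ⟨φ, hφ, h⟩ := hx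
    obtain ⟨ψ, hψ, k⟩ := hy
    refine ⟨φ + ψ, by rw [map_add, hφ, hψ]; rfl, ?_⟩
    filter_upwards [h, k] with a ha ka
    rw [map_add, ha, ka, Pi.add_apply, BalTensor.add_tmul]

theorem toGermLeft_injective (hinj : Function.Injective f) (hf : ColonGenerating f)
    (hS : ∀ (r : R) (s : S), r • s = f r * s) (M : Type u) [AddCommGroup M] [Module Rᵐᵒᵖ M] :
    Function.Injective (toGermLeft hinj hS M) := by
  refine (injective_iff_map_eq_zero _).2 fun x hx => ?_
  obtain ⟨φ, hφ, h⟩ := exists_toGermLeft_eq hinj hS x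
  have h0 : φ =ᶠ[rightColonFilter f] 0 := Filter.Germ.coe_eq.1 (hφ.symm.trans hx)
  refine eq_zero_of_one_mem_rightMul (rightAct hS M) (hf.one_mem_rightMul (h.and h0)) ?_
  rintro a ⟨ha, ha0⟩
  rw [ha, ha0]
  exact BalTensor.zero_tmul _

theorem toGermLeft_map (hinj : Function.Injective f)
    (hS : ∀ (r : R) (s : S), r • s = f r * s) {M M' : Type u} [AddCommGroup M] [Module Rᵐᵒᵖ M]
    [AddCommGroup M'] [Module Rᵐᵒᵖ M'] (i : M →ₗ[Rᵐᵒᵖ] M') (x : BalTensor R M S) :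
    toGermLeft hinj hS M' (BalTensor.map R i LinearMap.id x) =
      (toGermLeft hinj hS M x).map i := by
  induction x using BalTensor.induction_on with
  | zero =>
    rw [map_zero, map_zero, map_zero]
    exact congrArg Filter.Germ.ofFun (funext fun _ => (map_zero i).symm)
  | tmul m s =>
    rw [BalTensor.map_tmul, toGermLeft_tmul, toGermLeft_tmul, Filter.Germ.map_coe]
    exact congrArg Filter.Germ.ofFun (funext fun a => (map_smul i _ _).symm)
  | add x y hx hy =>
    rw [map_add, map_add, hx, hy, map_add]
    generalize toGermLeft hinj hS M x = g
    generalize toGermLeft hinj hS M y = k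
    induction g using Filter.Germ.inductionOn with
    | _ g =>
    induction k using Filter.Germ.inductionOn with
    | _ k =>
    exact congrArg Filter.Germ.ofFun (funext fun a => (map_add i _ _).symm)

/-- `- ⊗_R S` embeds naturally in the functor `M ↦ M^R / ∼`, which preserves injectivity. -/
theorem ColonGenerating.leftFlat (hinj : Function.Injective f) (hf : ColonGenerating f)
    (hS : ∀ (r : R) (s : S), r • s = f r * s) : LeftFlat R S := by
  intro M M' _ _ _ _ i hi
  refine (injective_iff_map_eq_zero _).2 fun x hx => toGermLeft_injective hinj hf hS M ?_
  have h := toGermLeft_map hinj hS i x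
  rw [hx, map_zero] at h
  rw [map_zero]
  generalize toGermLeft hinj hS M x = g at h
  induction g using Filter.Germ.inductionOn with
  | _ g =>
  refine Filter.Germ.coe_eq.2 ?_
  filter_upwards [Filter.Germ.coe_eq.1 h] with a ha
  exact hi (ha.symm.trans (map_zero i).symm)

end Left

/-- Generating right colons determine ring homomorphisms: if `1 = ∑ aᵢ sᵢ` with `s aᵢ ∈ R`, then
`g(s) = ∑ g(s aᵢ) h(sᵢ) = h(s)` whenever `g` and `h` agree on `R`. -/
theorem ColonGenerating.epi (hf : ColonGenerating f) :
    CategoryTheory.Epi (RingCat.ofHom f) := by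
  refine ⟨fun {T} g h hgh => RingCat.hom_ext (RingHom.ext fun s => ?_)⟩
  have agree : ∀ r, g.hom (f r) = h.hom (f r) := fun r =>
    congrArg (fun k => k.hom r) hgh
  suffices ∀ y ∈ Intermediate.rightMul (rightColon f s) (Intermediate.full f),
      g.hom s * h.hom y = h.hom (s * y) by simpa using this 1 (hf s).2
  intro y hy
  induction hy using AddSubgroup.closure_induction with
  | mem y hy =>
    obtain ⟨a, ⟨c, hc⟩, t, -, rfl⟩ := hy
    rw [map_mul, ← mul_assoc, ← agree, ← map_mul, ← mul_assoc, ← hc, agree, map_mul]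
  | zero => simp
  | add y z _ _ hy hz => rw [map_add, mul_add, hy, hz, mul_add, map_add]
  | neg y _ hy => rw [map_neg, mul_neg, hy, mul_neg, map_neg]

theorem ColonGenerating.isPerfectSymmetric (hinj : Function.Injective f)
    (hf : ColonGenerating f) : IsPerfectSymmetric f where
  epi := hf.epi
  leftFlat := by
    let _ : Module R S := Module.compHom S f
    exact hf.leftFlat hinj fun _ _ => rfl
  rightFlat := by
    let _ : Module Rᵐᵒᵖ S := Module.compHom S f.op
    exact hf.rightFlat hinj fun _ _ => rfl

end Flatness

/-! ### Flat epimorphisms have generating colons -/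

section Converse

open MulOpposite

variable {R S : Type u} [Ring R] [Ring S] {f : R →+* S}

section Right

variable [Module Rᵐᵒᵖ S]

/-- The ring homomorphism `S → End(S ⊗_R N × S)` obtained from the diagonal action by conjugating
with the unipotent `(m, x) ↦ (m + 1 ⊗ φ(x), x)`. -/
def leftTwist (hS : ∀ (r : R) (s : S), op r • s = s * f r) {N : Type u} [AddCommGroup N]
    [Module R N] (φ : S →+ N) : S →+* AddMonoid.End (BalTensor R S N × S) where
  toFun t :=
    { toFun := fun p => (leftAct hS N t p.1 - BalTensor.tmul R t (φ p.2) +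
        BalTensor.tmul R 1 (φ (t * p.2)), t * p.2)
      map_zero' := by simp [BalTensor.tmul_zero]
      map_add' := fun p q => by
        refine Prod.ext ?_ (mul_add _ _ _)
        simp only [Prod.fst_add, Prod.snd_add, map_add, mul_add, BalTensor.tmul_add]
        abel }
  map_one' := AddMonoidHom.ext fun p => by simp; rfl
  map_zero' := AddMonoidHom.ext fun p => by
    simp only [AddMonoidHom.coe_mk, ZeroHom.coe_mk, map_zero, BalTensor.zero_tmul, zero_mul,
      BalTensor.tmul_zero, sub_zero, add_zero]
    rfl
  map_mul' t t' := AddMonoidHom.ext fun p => by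
    refine Prod.ext ?_ (mul_assoc _ _ _)
    change leftAct hS N (t * t') p.1 - BalTensor.tmul R (t * t') (φ p.2) +
        BalTensor.tmul R 1 (φ (t * t' * p.2)) =
      leftAct hS N t (leftAct hS N t' p.1 - BalTensor.tmul R t' (φ p.2) +
        BalTensor.tmul R 1 (φ (t' * p.2))) - BalTensor.tmul R t (φ (t' * p.2)) +
        BalTensor.tmul R 1 (φ (t * (t' * p.2)))
    rw [map_mul, AddMonoid.End.coe_mul, Function.comp_apply, map_add, map_sub, leftAct_tmul,
      leftAct_tmul, mul_one, mul_assoc]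
    abel
  map_add' t t' := AddMonoidHom.ext fun p => by
    refine Prod.ext ?_ (add_mul _ _ _)
    change leftAct hS N (t + t') p.1 - BalTensor.tmul R (t + t') (φ p.2) +
        BalTensor.tmul R 1 (φ ((t + t') * p.2)) =
      leftAct hS N t p.1 - BalTensor.tmul R t (φ p.2) + BalTensor.tmul R 1 (φ (t * p.2)) +
      (leftAct hS N t' p.1 - BalTensor.tmul R t' (φ p.2) + BalTensor.tmul R 1 (φ (t' * p.2)))
    have h : leftAct hS N (t + t') p.1 = leftAct hS N t p.1 + leftAct hS N t' p.1 := by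
      rw [map_add]; rfl
    rw [h, add_mul, map_add, BalTensor.add_tmul, BalTensor.tmul_add]
    abel

/-- If `f` is an epimorphism, then `1 ⊗ φ(s) = s ⊗ φ(1)` in `S ⊗_R N` for every left `R`-linear
`φ : S → N`: the twist by `φ` of the action of `S` on `S ⊗_R N × S` agrees with the untwisted
action on `R`, hence on `S`. -/
theorem one_tmul_eq_of_epi [CategoryTheory.Epi (RingCat.ofHom f)]
    (hS : ∀ (r : R) (s : S), op r • s = s * f r) {N : Type u} [AddCommGroup N]
    [Module R N] (φ : S →+ N) (hφ : ∀ r s, φ (f r * s) = r • φ s) (s : S) :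
    BalTensor.tmul R 1 (φ s) = BalTensor.tmul R s (φ 1) := by
  have h : RingCat.ofHom (leftTwist hS (0 : S →+ N)) = RingCat.ofHom (leftTwist hS φ) := by
    rw [← CategoryTheory.cancel_epi (RingCat.ofHom f)]
    refine RingCat.hom_ext (RingHom.ext fun r => AddMonoidHom.ext fun p => ?_)
    refine Prod.ext ?_ rfl
    change leftAct hS N (f r) p.1 - BalTensor.tmul R (f r) 0 + BalTensor.tmul R 1 0 =
      leftAct hS N (f r) p.1 - BalTensor.tmul R (f r) (φ p.2) + BalTensor.tmul R 1 (φ (f r * p.2))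
    rw [hφ, ← BalTensor.smul_tmul, hS, one_mul, BalTensor.tmul_zero, BalTensor.tmul_zero]
    abel
  have h1 := congrArg (fun k => (k.hom s ((0, 1) : BalTensor R S N × S)).1) h
  change leftAct hS N s 0 - BalTensor.tmul R s 0 + BalTensor.tmul R 1 0 =
    leftAct hS N s 0 - BalTensor.tmul R s (φ 1) + BalTensor.tmul R 1 (φ (s * 1)) at h1
  rw [map_zero, BalTensor.tmul_zero, BalTensor.tmul_zero, mul_one] at h1
  rw [← sub_eq_zero, ← neg_add_eq_sub]
  simpa using h1.symm

/-- `S ⊗_R R/I = 0` forces `S I = S`. -/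
theorem one_mem_leftMul_of_tmul_eq_zero (hS : ∀ (r : R) (s : S), op r • s = s * f r)
    (I : Submodule R R) (h : BalTensor.tmul R (1 : S) (I.mkQ 1) = 0) :
    (1 : S) ∈ (Intermediate.full f).leftMul (I : Set R) := by
  let A : AddSubgroup S := (Intermediate.full f).leftMul (I : Set R)
  let c (s : S) : R ⧸ I →+ S ⧸ A := QuotientAddGroup.map I.toAddSubgroup A
    ((AddMonoidHom.mulLeft s).comp f.toAddMonoidHom)
    fun a ha => AddSubgroup.subset_closure ⟨s, trivial, a, ha, rfl⟩
  have hc (s : S) (r : R) : c s (I.mkQ r) = QuotientAddGroup.mk (s * f r) := rfl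
  have key := congrArg (BalTensor.lift (P := S ⧸ A)
    { toFun := c
      map_zero' := AddMonoidHom.ext fun n => by
        obtain ⟨r, rfl⟩ := I.mkQ_surjective n
        rw [hc, zero_mul]; rfl
      map_add' := fun s t => AddMonoidHom.ext fun n => by
        obtain ⟨r, rfl⟩ := I.mkQ_surjective n
        rw [AddMonoidHom.add_apply, hc, hc, hc, add_mul]; rfl }
    (by
      intro s r n
      obtain ⟨r', rfl⟩ := I.mkQ_surjective n
      change c (op r • s) (I.mkQ r') = c s (r • I.mkQ r')
      rw [← map_smul, hc, hc, hS, smul_eq_mul, map_mul, mul_assoc])) h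
  rw [BalTensor.lift_tmul, map_zero] at key
  refine (QuotientAddGroup.eq_zero_iff (N := A) (1 : S)).1 (Eq.trans ?_ key)
  change _ = c 1 (I.mkQ 1)
  rw [hc, map_one, mul_one]

variable [Module R S]

/-- `R/(R : s)` embeds in `S/R` by `1 ↦ s`, and `S ⊗_R S/R = 0` as `f` is an epimorphism, so
flatness gives `S ⊗_R R/(R : s) = 0`. -/
theorem one_mem_leftMul_leftColon [CategoryTheory.Epi (RingCat.ofHom f)]
    (hS : ∀ (r : R) (s : S), op r • s = s * f r) (hS' : ∀ (r : R) (s : S), r • s = f r * s)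
    (hflat : RightFlat R S) (s : S) :
    (1 : S) ∈ (Intermediate.full f).leftMul (leftColon f s) := by
  let j : R →ₗ[R] S := LinearMap.toSpanSingleton R S 1
  let π : S →ₗ[R] S ⧸ LinearMap.range j := (LinearMap.range j).mkQ
  let ψ : R →ₗ[R] S ⧸ LinearMap.range j := LinearMap.toSpanSingleton R _ (π s)
  have hj (r : R) : j r = f r := by
    rw [LinearMap.toSpanSingleton_apply, hS', mul_one]
  have hψ (r : R) : ψ r = π (f r * s) := by
    rw [LinearMap.toSpanSingleton_apply, ← map_smul, hS']
  have hker : (LinearMap.ker ψ : Set R) = leftColon f s := by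
    ext r
    rw [SetLike.mem_coe, LinearMap.mem_ker, hψ]
    refine (Submodule.Quotient.mk_eq_zero _).trans ?_
    exact exists_congr fun a => by rw [hj]
  rw [← hker]
  refine one_mem_leftMul_of_tmul_eq_zero hS _ ?_
  have hi : Function.Injective ((LinearMap.ker ψ).liftQ ψ le_rfl) :=
    LinearMap.ker_eq_bot.1 (Submodule.ker_liftQ_eq_bot _ _ _ le_rfl)
  refine (injective_iff_map_eq_zero _).1 (hflat _ _ _ hi) _ ?_
  have h1 : π 1 = 0 :=
    (Submodule.Quotient.mk_eq_zero _).2 ⟨1, by rw [hj, map_one]⟩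
  have := one_tmul_eq_of_epi hS π.toAddMonoidHom (fun r s => by
    rw [LinearMap.toAddMonoidHom_coe, ← hS', map_smul]) s
  rw [LinearMap.toAddMonoidHom_coe, h1, BalTensor.tmul_zero] at this
  rw [BalTensor.map_tmul, Submodule.mkQ_apply, Submodule.liftQ_apply, hψ, map_one f, one_mul]
  exact this

end Right

section Left

variable [Module R S]

/-- The ring homomorphism `Sᵒᵖ → End(M ⊗_R S × S)` obtained from the diagonal right action by
conjugating with the unipotent `(m, x) ↦ (m + φ(x) ⊗ 1, x)`. -/
def rightTwist (hS : ∀ (r : R) (s : S), r • s = f r * s) {M : Type u} [AddCommGroup M]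
    [Module Rᵐᵒᵖ M] (φ : S →+ M) : Sᵐᵒᵖ →+* AddMonoid.End (BalTensor R M S × S) where
  toFun t :=
    { toFun := fun p => (rightAct hS M t p.1 - BalTensor.tmul R (φ p.2) t.unop +
        BalTensor.tmul R (φ (p.2 * t.unop)) 1, p.2 * t.unop)
      map_zero' := by simp [BalTensor.zero_tmul]
      map_add' := fun p q => by
        refine Prod.ext ?_ (add_mul _ _ _)
        simp only [Prod.fst_add, Prod.snd_add, map_add, add_mul, BalTensor.add_tmul]
        abel }
  map_one' := AddMonoidHom.ext fun p => by simp; rfl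
  map_zero' := AddMonoidHom.ext fun p => by
    simp only [AddMonoidHom.coe_mk, ZeroHom.coe_mk, map_zero, BalTensor.zero_tmul, mul_zero,
      BalTensor.tmul_zero, sub_zero, add_zero, unop_zero]
    rfl
  map_mul' t t' := AddMonoidHom.ext fun p => by
    refine Prod.ext ?_ (mul_assoc _ _ _).symm
    change rightAct hS M (t * t') p.1 - BalTensor.tmul R (φ p.2) (t'.unop * t.unop) +
        BalTensor.tmul R (φ (p.2 * (t'.unop * t.unop))) 1 =
      rightAct hS M t (rightAct hS M t' p.1 - BalTensor.tmul R (φ p.2) t'.unop +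
        BalTensor.tmul R (φ (p.2 * t'.unop)) 1) - BalTensor.tmul R (φ (p.2 * t'.unop)) t.unop +
        BalTensor.tmul R (φ (p.2 * t'.unop * t.unop)) 1
    rw [map_mul, AddMonoid.End.coe_mul, Function.comp_apply, map_add, map_sub, rightAct_tmul,
      rightAct_tmul, one_mul, mul_assoc]
    abel
  map_add' t t' := AddMonoidHom.ext fun p => by
    refine Prod.ext ?_ (mul_add _ _ _)
    change rightAct hS M (t + t') p.1 - BalTensor.tmul R (φ p.2) (t.unop + t'.unop) +
        BalTensor.tmul R (φ (p.2 * (t.unop + t'.unop))) 1 =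
      rightAct hS M t p.1 - BalTensor.tmul R (φ p.2) t.unop +
        BalTensor.tmul R (φ (p.2 * t.unop)) 1 +
      (rightAct hS M t' p.1 - BalTensor.tmul R (φ p.2) t'.unop +
        BalTensor.tmul R (φ (p.2 * t'.unop)) 1)
    have h : rightAct hS M (t + t') p.1 = rightAct hS M t p.1 + rightAct hS M t' p.1 := by
      rw [map_add]; rfl
    rw [h, mul_add, map_add, BalTensor.add_tmul, BalTensor.tmul_add]
    abel

/-- If `f` is an epimorphism, then `φ(s) ⊗ 1 = φ(1) ⊗ s` in `M ⊗_R S` for every right `R`-linear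
`φ : S → M`: the twist by `φ` of the action of `S` on `M ⊗_R S × S` agrees with the untwisted
action on `R`, hence on `S`. -/
theorem tmul_one_eq_of_epi [CategoryTheory.Epi (RingCat.ofHom f)]
    (hS : ∀ (r : R) (s : S), r • s = f r * s) {M : Type u} [AddCommGroup M]
    [Module Rᵐᵒᵖ M] (φ : S →+ M) (hφ : ∀ r s, φ (s * f r) = op r • φ s) (s : S) :
    BalTensor.tmul R (φ s) 1 = BalTensor.tmul R (φ 1) s := by
  -- The twists are antihomomorphisms on `S`, that is, homomorphisms to the opposite ring.
  let E := (AddMonoid.End (BalTensor R M S × S))ᵐᵒᵖ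
  let L (φ : S →+ M) : S →+* E :=
    (rightTwist hS φ).op.comp (RingEquiv.opOp S : S →+* Sᵐᵒᵖᵐᵒᵖ)
  have hL (φ : S →+ M) (t : S) : L φ t = op (rightTwist hS φ (op t)) := rfl
  have h : RingCat.ofHom (L 0) = RingCat.ofHom (L φ) := by
    rw [← CategoryTheory.cancel_epi (RingCat.ofHom f)]
    refine RingCat.hom_ext (RingHom.ext fun r => unop_injective (AddMonoidHom.ext fun p => ?_))
    refine Prod.ext ?_ rfl
    change rightAct hS M (op (f r)) p.1 - BalTensor.tmul R 0 (f r) + BalTensor.tmul R 0 1 =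
      rightAct hS M (op (f r)) p.1 - BalTensor.tmul R (φ p.2) (f r) +
        BalTensor.tmul R (φ (p.2 * f r)) 1
    rw [hφ, BalTensor.smul_tmul, hS, mul_one, BalTensor.zero_tmul, BalTensor.zero_tmul]
    abel
  have h1 := congrArg (fun k => ((k.hom s).unop ((0, 1) : BalTensor R M S × S)).1) h
  change rightAct hS M (op s) 0 - BalTensor.tmul R 0 s + BalTensor.tmul R 0 1 =
    rightAct hS M (op s) 0 - BalTensor.tmul R (φ 1) s + BalTensor.tmul R (φ (1 * s)) 1 at h1
  rw [map_zero, BalTensor.zero_tmul, BalTensor.zero_tmul, one_mul] at h1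
  rw [← sub_eq_zero, ← neg_add_eq_sub]
  simpa using h1.symm

/-- `R/J ⊗_R S = 0` forces `J S = S`. -/
theorem one_mem_rightMul_of_tmul_eq_zero (hS : ∀ (r : R) (s : S), r • s = f r * s)
    (J : Submodule Rᵐᵒᵖ R) (h : BalTensor.tmul R (J.mkQ 1) (1 : S) = 0) :
    (1 : S) ∈ Intermediate.rightMul (J : Set R) (Intermediate.full f) := by
  let A : AddSubgroup S := Intermediate.rightMul (J : Set R) (Intermediate.full f)
  let c (s : S) : R ⧸ J →+ S ⧸ A := QuotientAddGroup.map J.toAddSubgroup A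
    ((AddMonoidHom.mulRight s).comp f.toAddMonoidHom)
    fun a ha => AddSubgroup.subset_closure ⟨a, ha, s, trivial, rfl⟩
  have hc (s : S) (r : R) : c s (J.mkQ r) = QuotientAddGroup.mk (f r * s) := rfl
  let C : S →+ R ⧸ J →+ S ⧸ A :=
    { toFun := c
      map_zero' := AddMonoidHom.ext fun n => by
        obtain ⟨r, rfl⟩ := J.mkQ_surjective n
        rw [hc, mul_zero]; rfl
      map_add' := fun s t => AddMonoidHom.ext fun n => by
        obtain ⟨r, rfl⟩ := J.mkQ_surjective n
        rw [AddMonoidHom.add_apply, hc, hc, hc, mul_add]; rfl }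
  have key := congrArg (BalTensor.lift C.flip
    (by
      intro n r s
      obtain ⟨r', rfl⟩ := J.mkQ_surjective n
      change c s (op r • J.mkQ r') = c (r • s) (J.mkQ r')
      rw [← map_smul, hc, hc, hS, op_smul_eq_mul, map_mul, mul_assoc])) h
  rw [BalTensor.lift_tmul, map_zero] at key
  refine (QuotientAddGroup.eq_zero_iff (N := A) (1 : S)).1 (Eq.trans ?_ key)
  change _ = c 1 (J.mkQ 1)
  rw [hc, map_one, mul_one]

variable [Module Rᵐᵒᵖ S]

/-- `R/(s : R)` embeds in `S/R` by `1 ↦ s`, and `S/R ⊗_R S = 0` as `f` is an epimorphism, so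
flatness gives `R/(s : R) ⊗_R S = 0`. -/
theorem one_mem_rightMul_rightColon [CategoryTheory.Epi (RingCat.ofHom f)]
    (hS : ∀ (r : R) (s : S), r • s = f r * s) (hS' : ∀ (r : R) (s : S), op r • s = s * f r)
    (hflat : LeftFlat R S) (s : S) :
    (1 : S) ∈ Intermediate.rightMul (rightColon f s) (Intermediate.full f) := by
  let j : R →ₗ[Rᵐᵒᵖ] S :=
    { toFun := f
      map_add' := map_add f
      map_smul' := fun r a => by
        induction r using MulOpposite.rec' with
        | h r => simp [hS'] }
  let π : S →ₗ[Rᵐᵒᵖ] S ⧸ LinearMap.range j := (LinearMap.range j).mkQ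
  let m : R →ₗ[Rᵐᵒᵖ] S :=
    { toFun := fun r => s * f r
      map_add' := fun a b => by rw [map_add, mul_add]
      map_smul' := fun r a => by
        induction r using MulOpposite.rec' with
        | h r => simp [hS', mul_assoc] }
  let ψ : R →ₗ[Rᵐᵒᵖ] S ⧸ LinearMap.range j := π ∘ₗ m
  have hψ (r : R) : ψ r = π (s * f r) := rfl
  have hker : (LinearMap.ker ψ : Set R) = rightColon f s := by
    ext r
    rw [SetLike.mem_coe, LinearMap.mem_ker, hψ]
    exact Submodule.Quotient.mk_eq_zero _
  rw [← hker]
  refine one_mem_rightMul_of_tmul_eq_zero hS _ ?_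
  have hi : Function.Injective ((LinearMap.ker ψ).liftQ ψ le_rfl) :=
    LinearMap.ker_eq_bot.1 (Submodule.ker_liftQ_eq_bot _ _ _ le_rfl)
  refine (injective_iff_map_eq_zero _).1 (hflat _ _ _ hi) _ ?_
  have h1 : π 1 = 0 := (Submodule.Quotient.mk_eq_zero _).2 ⟨1, map_one f⟩
  have := tmul_one_eq_of_epi hS π.toAddMonoidHom (fun r s => by
    rw [LinearMap.toAddMonoidHom_coe, ← hS', map_smul]) s
  rw [LinearMap.toAddMonoidHom_coe, h1, BalTensor.zero_tmul] at this
  rw [BalTensor.map_tmul, Submodule.mkQ_apply, Submodule.liftQ_apply, hψ, map_one f, mul_one]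
  exact this

end Left

theorem IsPerfectSymmetric.colonGenerating (hf : IsPerfectSymmetric f) : ColonGenerating f := by
  let _ : Module R S := Module.compHom S f
  let _ : Module Rᵐᵒᵖ S := Module.compHom S f.op
  have := hf.epi
  exact fun s => ⟨one_mem_leftMul_leftColon (fun _ _ => rfl) (fun _ _ => rfl) hf.rightFlat s,
    one_mem_rightMul_rightColon (fun _ _ => rfl) (fun _ _ => rfl) hf.leftFlat s⟩

end Converse

/-! ### Generating colons embed an extension into the maximal symmetric ring of quotients -/

section Embedding

open MulOpposite

variable {R T : Type u} [Ring R] [Ring T] {g : R →+* T}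

/-- `(R : t)` as a left ideal. -/
def leftColonIdeal (g : R →+* T) (t : T) : Ideal R where
  carrier := leftColon g t
  add_mem' := add_mem_leftColon
  zero_mem' := ⟨0, by simp⟩
  smul_mem' b _ ha := mul_mem_leftColon b ha

/-- `(t : R)` as a right ideal. -/
def rightColonIdeal (g : R →+* T) (t : T) : Submodule Rᵐᵒᵖ R where
  carrier := rightColon g t
  add_mem' := add_mem_rightColon
  zero_mem' := ⟨0, by simp⟩
  smul_mem' b _ ha := mul_mem_rightColon b.unop ha

theorem ColonGenerating.eq_zero_of_left (hg : ColonGenerating g) {t x : T}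
    (h : ∀ a ∈ leftColon g t, g a * x = 0) : x = 0 :=
  eq_zero_of_one_mem_leftMul (Module.toAddMonoidEnd T T) (hg t).1 h

theorem ColonGenerating.eq_zero_of_right (hg : ColonGenerating g) {t x : T}
    (h : ∀ a ∈ rightColon g t, x * g a = 0) : x = 0 :=
  eq_zero_of_one_mem_rightMul (Module.toAddMonoidEnd Tᵐᵒᵖ T) (hg t).2 h

theorem ColonGenerating.denseLeft (hinj : Function.Injective g) (hg : ColonGenerating g) (t : T) :
    DenseLeft (leftColonIdeal g t) := by
  intro a b hb
  by_contra! h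
  refine hb (hinj ((hg.eq_zero_of_left (t := g a * t) fun r hr => ?_).trans (map_zero g).symm))
  rw [← map_mul, h r, map_zero]
  change g (r * a) * t ∈ g.range
  rwa [map_mul, mul_assoc]

theorem ColonGenerating.denseRight (hinj : Function.Injective g) (hg : ColonGenerating g) (t : T) :
    DenseRight (rightColonIdeal g t) := by
  intro a b hb
  by_contra! h
  refine hb (hinj ((hg.eq_zero_of_right (t := t * g a) fun r hr => ?_).trans (map_zero g).symm))
  rw [← map_mul, h r, map_zero]
  change t * g (a * r) ∈ g.range
  rwa [map_mul, ← mul_assoc]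

/-- The pair of the right multiplication by `t` on `(R : t)` and the left multiplication by `t`
on `(t : R)`. -/
noncomputable def multiplicationPair (hinj : Function.Injective g) (hg : ColonGenerating g)
    (t : T) : CompatiblePair R where
  I := leftColonIdeal g t
  J := rightColonIdeal g t
  denseI := hg.denseLeft hinj t
  denseJ := hg.denseRight hinj t
  f :=
    { toFun := fun x => leftCoeff g t x
      map_add' := fun x y => leftCoeff_eq hinj <| by
        rw [map_add, map_leftCoeff x.2, map_leftCoeff y.2, Submodule.coe_add, map_add, add_mul]
      map_smul' := fun r x => leftCoeff_eq hinj <| by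
        rw [RingHom.id_apply, Submodule.coe_smul, smul_eq_mul, smul_eq_mul, map_mul,
          map_leftCoeff x.2, map_mul, mul_assoc] }
  g :=
    { toFun := fun x => rightCoeff g t x
      map_add' := fun x y => rightCoeff_eq hinj <| by
        rw [map_add, map_rightCoeff x.2, map_rightCoeff y.2, Submodule.coe_add, map_add, mul_add]
      map_smul' := fun r x => rightCoeff_eq hinj <| by
        induction r using MulOpposite.rec' with
        | h r =>
          rw [RingHom.id_apply, Submodule.coe_smul, op_smul_eq_mul, op_smul_eq_mul, map_mul,
            map_rightCoeff x.2, map_mul, mul_assoc] }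
  compat := fun i j => hinj <| by
    change g (leftCoeff g t i * j) = g (i * rightCoeff g t j)
    rw [map_mul, map_leftCoeff i.2, map_mul, map_rightCoeff j.2, mul_assoc]

/-- The embedding `T → Q` over `R`, where `Q` is the maximal symmetric ring of quotients. -/
noncomputable def toMaxSym (hinj : Function.Injective g) (hg : ColonGenerating g) :
    T →+* MaxSym R where
  toFun t := Quotient.mk (CompatiblePair.setoid R) (multiplicationPair hinj hg t)
  map_one' := MaxSym.sound fun x _ _ => leftCoeff_eq hinj <| by
    change g (x * 1) = _
    rw [map_mul, map_one]
  map_zero' := MaxSym.sound fun x _ _ => leftCoeff_eq hinj <| by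
    change g (x * 0) = _
    rw [map_mul, map_zero]
  map_add' t t' := MaxSym.sound fun x _ hq => leftCoeff_eq hinj <| by
    change g (leftCoeff g t x + leftCoeff g t' x) = _
    rw [map_add, map_leftCoeff hq.1, map_leftCoeff hq.2, mul_add]
  map_mul' t t' := MaxSym.sound fun x _ hq => leftCoeff_eq hinj <| by
    obtain ⟨h, h'⟩ := hq
    exact (map_leftCoeff h').trans
      ((congrArg (· * t') (map_leftCoeff h)).trans (mul_assoc _ _ _))

theorem toMaxSym_comp (hinj : Function.Injective g) (hg : ColonGenerating g) :
    (toMaxSym hinj hg).comp g = MaxSym.of R :=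
  RingHom.ext fun r => MaxSym.sound fun x _ _ => leftCoeff_eq hinj (map_mul g x r)

theorem toMaxSym_injective (hinj : Function.Injective g) (hg : ColonGenerating g) :
    Function.Injective (toMaxSym hinj hg) := by
  refine (injective_iff_map_eq_zero _).2 fun t ht => hg.eq_zero_of_left (t := t) fun a ha => ?_
  have h : leftCoeff g t a = a * 0 :=
    (CompatiblePair.rel_iff _ _).1 (Quotient.exact ht) a ha trivial
  rw [← map_leftCoeff ha, h, mul_zero, map_zero]

theorem MaxSym.of_injective (R : Type u) [Ring R] : Function.Injective (MaxSym.of R) := by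
  refine (injective_iff_map_eq_zero _).2 fun r hr => ?_
  have h : (1 : R) * r = 1 * 0 :=
    (CompatiblePair.rel_iff _ _).1 (Quotient.exact hr) 1 trivial trivial
  simpa using h

end Embedding

/-! ### The symmetric Morita operation and its iterates -/

section Iterates

variable {R Q : Type u} [Ring R] [Ring Q] {ι : R →+* Q}

theorem Intermediate.incl_injective (hι : Function.Injective ι) (S : Intermediate ι) :
    Function.Injective (S.incl ι) := fun _ _ h => hι (congrArg Subtype.val h)

theorem morita_le (S : Intermediate ι) : morita S ≤ S := fun _ h => h.1

theorem colonGenerating_of_morita_eq {S : Intermediate ι} (hS : morita S = S) :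
    ColonGenerating (S.incl ι) := by
  intro s
  have hcond : MoritaCond S s := by
    have h : (s : Q) ∈ (morita S).1 := by rw [hS]; exact s.2
    exact h.2
  obtain ⟨hl, hr⟩ := hcond 1
  rw [map_one, one_mul, Intermediate.leftMul_eq_iff] at hl
  rw [map_one, mul_one, Intermediate.rightMul_eq_iff] at hr
  constructor
  · suffices ∀ y ∈ S.leftMul (leftColon ι s),
        ∃ z ∈ (Intermediate.full (S.incl ι)).leftMul (leftColon (S.incl ι) s), (z : Q) = y by
      obtain ⟨z, hz, hz1⟩ := this 1 hl
      rwa [show z = 1 from Subtype.ext hz1] at hz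
    intro y hy
    induction hy using AddSubgroup.closure_induction with
    | mem y hy =>
      obtain ⟨t, ht, a, ⟨c, hc⟩, rfl⟩ := hy
      exact ⟨⟨t, ht⟩ * S.incl ι a,
        AddSubgroup.subset_closure ⟨⟨t, ht⟩, trivial, a, ⟨c, Subtype.ext hc⟩, rfl⟩, rfl⟩
    | zero => exact ⟨0, zero_mem _, rfl⟩
    | add _ _ _ _ hx hy =>
      obtain ⟨x, hx, rfl⟩ := hx
      obtain ⟨y, hy, rfl⟩ := hy
      exact ⟨x + y, add_mem hx hy, rfl⟩
    | neg _ _ hx =>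
      obtain ⟨x, hx, rfl⟩ := hx
      exact ⟨-x, neg_mem hx, rfl⟩
  · suffices ∀ y ∈ Intermediate.rightMul (rightColon ι s) S,
        ∃ z ∈ Intermediate.rightMul (rightColon (S.incl ι) s) (Intermediate.full (S.incl ι)),
          (z : Q) = y by
      obtain ⟨z, hz, hz1⟩ := this 1 hr
      rwa [show z = 1 from Subtype.ext hz1] at hz
    intro y hy
    induction hy using AddSubgroup.closure_induction with
    | mem y hy =>
      obtain ⟨a, ⟨c, hc⟩, t, ht, rfl⟩ := hy
      exact ⟨S.incl ι a * ⟨t, ht⟩,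
        AddSubgroup.subset_closure ⟨a, ⟨c, Subtype.ext hc⟩, ⟨t, ht⟩, trivial, rfl⟩, rfl⟩
    | zero => exact ⟨0, zero_mem _, rfl⟩
    | add _ _ _ _ hx hy =>
      obtain ⟨x, hx, rfl⟩ := hx
      obtain ⟨y, hy, rfl⟩ := hy
      exact ⟨x + y, add_mem hx hy, rfl⟩
    | neg _ _ hx =>
      obtain ⟨x, hx, rfl⟩ := hx
      exact ⟨-x, neg_mem hx, rfl⟩

/-- The Morita operation does not remove elements of an extension with generating colons. -/
theorem ColonGenerating.range_le_morita {T : Type u} [Ring T] {g : R →+* T}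
    (hg : ColonGenerating g) {h : T →+* Q} (hcomp : h.comp g = ι) {S : Intermediate ι}
    (hS : h.range ≤ S.1) : h.range ≤ (morita S).1 := by
  have hh (r : R) : h (g r) = ι r := congrArg (fun k => k r) hcomp
  rintro _ ⟨t, rfl⟩
  refine ⟨hS ⟨t, rfl⟩, fun r => ⟨?_, ?_⟩⟩
  · rw [Intermediate.leftMul_eq_iff]
    suffices ∀ y ∈ (Intermediate.full g).leftMul (leftColon g (g r * t)),
        h y ∈ S.leftMul (leftColon ι (ι r * h t)) by simpa using this 1 (hg _).1
    intro y hy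
    induction hy using AddSubgroup.closure_induction with
    | mem y hy =>
      obtain ⟨s, -, a, ⟨c, hc⟩, rfl⟩ := hy
      refine AddSubgroup.subset_closure ⟨h s, hS ⟨s, rfl⟩, a, ⟨c, ?_⟩, by rw [map_mul, hh]⟩
      rw [← hh c, hc, map_mul, map_mul, hh, hh]
    | zero => rw [map_zero]; exact zero_mem _
    | add x y _ _ hx hy => rw [map_add]; exact add_mem hx hy
    | neg x _ hx => rw [map_neg]; exact neg_mem hx
  · rw [Intermediate.rightMul_eq_iff]
    suffices ∀ y ∈ Intermediate.rightMul (rightColon g (t * g r)) (Intermediate.full g),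
        h y ∈ Intermediate.rightMul (rightColon ι (h t * ι r)) S by simpa using this 1 (hg _).2
    intro y hy
    induction hy using AddSubgroup.closure_induction with
    | mem y hy =>
      obtain ⟨a, ⟨c, hc⟩, s, -, rfl⟩ := hy
      refine AddSubgroup.subset_closure ⟨a, ⟨c, ?_⟩, h s, hS ⟨s, rfl⟩, by rw [map_mul, hh]⟩
      rw [← hh c, hc, map_mul, map_mul, hh, hh]
    | zero => rw [map_zero]; exact zero_mem _
    | add x y _ _ hx hy => rw [map_add]; exact add_mem hx hy
    | neg x _ hx => rw [map_neg]; exact neg_mem hx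

theorem moritaIter_zero (S : Intermediate ι) : moritaIter S 0 = S :=
  Ordinal.limitRecOn_zero ..

theorem moritaIter_add_one (S : Intermediate ι) (α : Ordinal.{u}) :
    moritaIter S (α + 1) = morita (moritaIter S α) :=
  Ordinal.limitRecOn_add_one ..

theorem moritaIter_limit (S : Intermediate ι) {α : Ordinal.{u}} (hα : Order.IsSuccLimit α) :
    (moritaIter S α).1 = ⨅ β, ⨅ _ : β < α, (moritaIter S β).1 := by
  unfold moritaIter
  rw [Ordinal.limitRecOn_limit _ _ _ _ hα]

theorem moritaIter_antitone (S : Intermediate ι) : Antitone (moritaIter S) := by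
  intro α β h
  induction β using Ordinal.limitRecOn with
  | zero => rw [nonpos_iff_eq_zero.1 h]
  | add_one β ih =>
    rcases h.eq_or_lt with rfl | h
    · exact le_rfl
    · rw [moritaIter_add_one]
      exact (morita_le _).trans (ih (Order.lt_add_one_iff.1 h))
  | limit β hβ ih =>
    rcases h.eq_or_lt with rfl | h
    · exact le_rfl
    · change (moritaIter S β).1 ≤ _
      rw [moritaIter_limit S hβ]
      exact iInf₂_le α h

/-- The descending sequence stabilises, as the ordinals do not inject into the set of
intermediate rings. -/
theorem exists_moritaIter_eq (S : Intermediate ι) :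
    ∃ γ : Ordinal.{u}, moritaIter S γ = moritaIter S (γ + 1) := by
  have h := not_injective_of_ordinal (moritaIter S)
  simp only [Function.Injective, not_forall] at h
  obtain ⟨α, β, heq, hne⟩ := h
  wlog hlt : α < β generalizing α β
  · exact this β α heq.symm (Ne.symm hne) ((not_lt.1 hlt).lt_of_ne (Ne.symm hne))
  refine ⟨α, le_antisymm ?_ (moritaIter_antitone S le_self_add)⟩
  rw [heq]
  exact moritaIter_antitone S (Order.add_one_le_iff.2 hlt)

theorem ColonGenerating.range_le_moritaIter {T : Type u} [Ring T] {g : R →+* T}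
    (hg : ColonGenerating g) {h : T →+* Q} (hcomp : h.comp g = ι) {S : Intermediate ι}
    (hS : h.range ≤ S.1) (α : Ordinal.{u}) : h.range ≤ (moritaIter S α).1 := by
  induction α using Ordinal.limitRecOn with
  | zero => rwa [moritaIter_zero]
  | add_one α ih =>
    rw [moritaIter_add_one]
    exact hg.range_le_morita hcomp ih
  | limit α hα ih =>
    rw [moritaIter_limit S hα]
    exact le_iInf₂ ih

end Iterates

/-! ### The total symmetric ring of quotients -/

theorem ColonGenerating.isTotalSymmetric {R : Type u} [Ring R] {S : Intermediate (MaxSym.of R)}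
    (hS : ColonGenerating (S.incl _))
    (hmax : ∀ (T : Type u) [Ring T] (g : R →+* T) (hinj : Function.Injective g)
      (hg : ColonGenerating g), (toMaxSym hinj hg).range ≤ S.1) :
    IsTotalSymmetric (S.incl (MaxSym.of R)) where
  injective := S.incl_injective (MaxSym.of_injective R)
  perfect := hS.isPerfectSymmetric (S.incl_injective (MaxSym.of_injective R))
  universal T _ g hinj hg := by
    have hcg := hg.colonGenerating
    let h : T →+* S.1 := (toMaxSym hinj hcg).codRestrict S.1 fun t => hmax T g hinj hcg ⟨t, rfl⟩
    have hcomp : h.comp g = S.incl _ := RingHom.ext fun r =>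
      Subtype.ext (congrArg (fun k => k r) (toMaxSym_comp hinj hcg))
    refine ⟨h, ⟨fun x y hxy => toMaxSym_injective hinj hcg (congrArg Subtype.val hxy), hcomp⟩,
      fun k hk => ?_⟩
    have := hg.epi
    have heq : RingCat.ofHom k = RingCat.ofHom h := by
      rw [← CategoryTheory.cancel_epi (RingCat.ofHom g), ← RingCat.ofHom_comp,
        ← RingCat.ofHom_comp, hk.2, hcomp]
    exact congrArg RingCat.Hom.hom heq

end SymQuot

theorem mainTheorem8 (R : Type u) [Ring R] :
    (∃ γ : Ordinal.{u}, SymQuot.moritaIter (SymQuot.maxSymTop R) γ =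
      SymQuot.moritaIter (SymQuot.maxSymTop R) (γ + 1)) ∧
    ∀ γ : Ordinal.{u}, SymQuot.moritaIter (SymQuot.maxSymTop R) γ =
        SymQuot.moritaIter (SymQuot.maxSymTop R) (γ + 1) →
      (SymQuot.moritaIter (SymQuot.maxSymTop R) γ).1 = SymQuot.totSym R ∧
      SymQuot.IsTotalSymmetric
        (SymQuot.Intermediate.incl (SymQuot.MaxSym.of R)
          (SymQuot.moritaIter (SymQuot.maxSymTop R) γ)) := by
  refine ⟨SymQuot.exists_moritaIter_eq _, fun γ hγ => ?_⟩
  rw [SymQuot.moritaIter_add_one] at hγ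
  have hcg := SymQuot.colonGenerating_of_morita_eq hγ.symm
  have htot := hcg.isTotalSymmetric fun T _ g hinj hg =>
    hg.range_le_moritaIter (SymQuot.toMaxSym_comp hinj hg) le_top γ
  refine ⟨le_antisymm (le_sSup ⟨_, htot.perfect⟩) (sSup_le ?_), htot⟩
  rintro T ⟨hT, hperf⟩
  have h := hperf.colonGenerating.range_le_moritaIter (h := T.subtype)
    (S := SymQuot.maxSymTop R) rfl le_top γ
  rwa [Subring.range_subtype] at h
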